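/- Let $T=\mathbb R/\mathbb Z$ with Lebesgue measure of total mass one, let $n\ge 1$ be an integer, and let $T_{2n-1}\subset C(T)$ be the space of real $1$-periodic trigonometric polynomials of degree at most $n-1$. Let $T_{2n-1}^\perp$ be the set of real $g\in L_\infty(T)$ with $\int_T g\tau=0$ for all $\tau\in T_{2n-1}$. For $h>0$ let $\chi_h=\frac1h\mathbf 1_{(-h/2,h/2)}$ on $\mathbb R$, let $\widetilde\chi_h(x)=\sum_{j\in\mathbb Z}\chi_h(x+j)$, let $(f*\chi_h)(x)=\int_{\mathbb R}f(x-t)\chi_h(t)\,dt$, let $\odot$ be the convolution on $T$, and let $\widetilde\chi_h^{\,j}$ be the $j$-th convolution power of $\widetilde\chi_h$ for $\odot$, with $\widetilde\chi_h^{\,0}=\widetilde\delta$ the Dirac measure at $0$. For $j\ge1$ let $E_n(\widetilde\chi_h^{\,j})_1=\inf_{\tau\in T_{2n-1}}\int_T|\widetilde\chi_h^{\,j}-\tau|$; for $j=0$ let $E_n(\widetilde\delta)_1=\inf_{\tau\in T_{2n-1}}\|\widetilde\delta-\tau\,dx\|_{TV}$ (total variation). For $f\in C(T)$ let $E_n(f)=\inf_{\tau\in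 T_{2n-1}}\|f-\tau\|$ (supremum norm) and $W_2(f,h)=\sup_x|f(x)-(f*\chi_h)(x)|$. For $g\in L_\infty(T)$ let $\|g\|$ be the essential supremum of $|g|$ and $W_2(g,h)=\|g-g*\chi_h\|$. For $j\ge0$ put $$F_j=2\Big(\frac2\pi\Big)^{j+1}\sum_{k=-\infty}^{\infty}(4k+1)^{-j-1}$$ (limit of the symmetric partial sums). (A) For every $h>0$ the series $\sum_{j\ge0}E_n(\widetilde\chi_h^{\,j})_1$ converges. For every $g\in T_{2n-1}^\perp$, $$g=\sum_{j=0}^\infty\widetilde\chi_h^{\,j}\odot(g-g*\chi_h)\quad\text{with convergence in }L_\infty(T),$$ $$\|g\|\le 2W_2(g,h)+E_n(\widetilde\chi_h^{\,2})_1\|g\|,\qquad\text{hence}\quad \|g\|\le 2\bigl(1-E_n(\widetilde\chi_h^{\,2})_1\bigr)^{-1}W_2(g,h)\ \text{ if }E_n(\widetilde\chi_h^{\,2})_1<1,$$ $$\|g\|\le\Big(1+\sum_{j=1}^\infty E_n(\widetilde\chi_h^{\,j})_1\Big)W_2(g,h),$$ and for every $f\in C(T)$, $$E_n(f)\le\Big(\sum_{j=0}^\infty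 E_n(\widetilde\chi_h^{\,j})_1\Big)W_2(f,h).$$ (B) For $h=1/(2n)$ one has $E_n(\widetilde\chi_h^{\,j})_1=F_j$ for all $j\ge0$; in particular $E_n(\widetilde\chi_h^{\,2})_1=1/2$. Moreover $\sum_{j=0}^\infty F_j=\sec 1+\tan 1$, and $3.408<\sec1+\tan1<3.409$. Consequently $$\|g\|\le(\sec1+\tan1)\,W_2\big(g,\tfrac1{2n}\big),\quad \|g\|\le4\,W_2\big(g,\tfrac1{2n}\big)\qquad(g\in T_{2n-1}^\perp),$$ $$E_n(f)\le(\sec1+\tan1)\,W_2\big(f,\tfrac1{2n}\big),\quad E_n(f)\le4\,W_2\big(f,\tfrac1{2n}\big)\qquad(f\in C(T)).$$ -/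

import Mathlib

open MeasureTheory Filter Topology

noncomputable section

namespace TPerp

/-- The circle `ℝ/ℤ`, with its Lebesgue measure `volume` of total mass one. -/
abbrev T : Type := UnitAddCircle

/-- The real trigonometric polynomials of period one and degree at most `n - 1`
(of dimension `2n - 1` for `n ≥ 1`), as a subspace of `C(T)`. -/
def trigPoly (n : ℕ) : Submodule ℝ C(T, ℝ) where
  carrier := {τ | ∃ a b : ℕ → ℝ, ∀ x : ℝ, τ (x : T) =
    ∑ j ∈ Finset.range n, a j * Real.cos (2 * Real.pi * j * x) +
    ∑ j ∈ Finset.Ico 1 n, b j * Real.sin (2 * Real.pi * j * x)}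
  zero_mem' := ⟨0, 0, fun x => by simp⟩
  add_mem' := by
    rintro σ τ ⟨a, b, h⟩ ⟨a', b', h'⟩
    refine ⟨a + a', b + b', fun x => ?_⟩
    simp only [ContinuousMap.add_apply, h, h', Pi.add_apply, add_mul, Finset.sum_add_distrib]
    ring
  smul_mem' := by
    rintro c τ ⟨a, b, h⟩
    refine ⟨c • a, c • b, fun x => ?_⟩
    simp only [ContinuousMap.smul_apply, h, Pi.smul_apply, smul_eq_mul, mul_add,
      Finset.mul_sum, mul_assoc]

/-- `g` (a representative of) an element of `L_∞(T)` orthogonal to `trigPoly n`. -/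
def IsPerp (n : ℕ) (g : T → ℝ) : Prop :=
  MemLp g ⊤ volume ∧ ∀ τ ∈ trigPoly n, ∫ x, g x * τ x = 0

/-- The norm of `L_∞(T)`, i.e. the essential supremum of `|u|`. -/
def essNorm (u : T → ℝ) : ℝ := (eLpNorm u ⊤ volume).toReal

/-- The characteristic function of `(-h/2, h/2)`, normed to have integral one. -/
def chi (h : ℝ) : ℝ → ℝ := (Set.Ioo (-h / 2) (h / 2)).indicator fun _ => 1 / h

/-- The convolution `f * χ_h` (over `ℝ`) of a function of period one with `χ_h`. -/
def steklov (h : ℝ) (f : T → ℝ) (x : T) : ℝ := ∫ t : ℝ, f (x - (t : T)) * chi h t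

theorem periodic_tsum_chi (h : ℝ) :
    Function.Periodic (fun x : ℝ => ∑' j : ℤ, chi h (x + j)) 1 := by
  intro x
  have := (Equiv.addRight (1 : ℤ)).tsum_eq fun j : ℤ => chi h (x + j)
  simp only [Equiv.coe_addRight, Int.cast_add, Int.cast_one] at this
  refine Eq.trans ?_ this
  exact tsum_congr fun j => congrArg _ (by ring)

/-- The periodization `∑_j χ_h(x + j)` of `χ_h`, as a function on the circle. -/
def chiPer (h : ℝ) : T → ℝ := (periodic_tsum_chi h).lift

/-- The convolution on the circle. -/
def circConv (u v : T → ℝ) (x : T) : ℝ := ∫ t : T, u t * v (x - t)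

/-- For `j ≥ 1`, the `j`-fold convolution power on the circle of the periodized `χ_h`. (The power
of exponent `0` is the Dirac measure, which is not a function; the value `0` here is not used.) -/
def chiPow (h : ℝ) : ℕ → T → ℝ
  | 0 => 0
  | 1 => chiPer h
  | j + 2 => circConv (chiPer h) (chiPow h (j + 1))

/-- The convolution of `u` with the `j`-th convolution power of the periodized `χ_h`;
for `j = 0` this is the convolution with the Dirac measure at `0`. -/
def powConv (h : ℝ) : ℕ → (T → ℝ) → T → ℝ
  | 0, u => u
  | j + 1, u => circConv (chiPow h (j + 1)) u

/-- Best uniform approximation of a continuous function by `trigPoly n`. -/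
def bestUnif (n : ℕ) (f : C(T, ℝ)) : ℝ := ⨅ τ : trigPoly n, ‖f - (τ : C(T, ℝ))‖

/-- Best `L_1`-approximation of an integrable function by `trigPoly n`. -/
def bestL1 (n : ℕ) (φ : T → ℝ) : ℝ := ⨅ τ : trigPoly n, ∫ x, |φ x - (τ : C(T, ℝ)) x|

/-- Best approximation of a finite signed measure by `trigPoly n` in the total variation norm
(which extends the `L_1` norm). -/
def bestTV (n : ℕ) (μ : SignedMeasure T) : ℝ :=
  ⨅ τ : trigPoly n, ((μ - (volume : Measure T).withDensityᵥ
    ((τ : C(T, ℝ)) : T → ℝ)).totalVariation Set.univ).toReal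

/-- The error of best `L_1`-approximation by `trigPoly n` of the `j`-th convolution power of the
periodized `χ_h`; the power of exponent `0` is the Dirac measure at `0`. -/
def chiErr (n : ℕ) (h : ℝ) : ℕ → ℝ
  | 0 => bestTV n (Measure.dirac (0 : T)).toSignedMeasure
  | j + 1 => bestL1 n (chiPow h (j + 1))

/-- `W₂(g, h)` for `g` in `L_∞(T)`: the norm in `L_∞(T)` of `g - g * χ_h`. -/
def W2ess (g : T → ℝ) (h : ℝ) : ℝ := essNorm fun x => g x - steklov h g x

/-- `W₂(f, h)` for continuous `f`: the supremum of `|f - f * χ_h|`. -/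
def W2 (f : C(T, ℝ)) (h : ℝ) : ℝ := ⨆ x : T, |f x - steklov h f x|

/-- `F_j = 2 (2/π)^(j+1) ∑_{k ∈ ℤ} (4k+1)^(-j-1)`. The bilateral series is the limit of its
symmetric partial sums, which matters for `j = 0` only. -/
def F (j : ℕ) : ℝ :=
  2 * (2 / Real.pi) ^ (j + 1) *
    ∑'[SummationFilter.symmetricIcc ℤ] k : ℤ, 1 / (4 * (k : ℝ) + 1) ^ (j + 1)

end TPerp

end

noncomputable section

namespace TPerp

open scoped Convolution ComplexConjugate
open ContinuousLinearMap (mul)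
open Real (sinc)
open SummationFilter (symmetricIcc)

/-! ### Convolution on the circle -/

/-! Write χ for the periodized kernel. The partial sums of ∑ χ^j ⊙ (g - χ ⊙ g) telescope to g - χ^N
⊙ g (`sub_sum_powConv`). If g is orthogonal to the trigonometric polynomials, then τ ⊙ g = 0 for
each such τ, so χ^N may be replaced by χ^N - τ and the remainder is at most E_n(χ^N)₁‖g‖
(`essNorm_circConv_le`). For continuous f the same decomposition works because E_n is subadditive
and E_n(φ ⊙ u) ≤ E_n(φ)₁‖u‖. The errors are summable since the Fourier coefficients sinc(πkh), k ≠
0, are bounded by some ρ < 1, and Parseval makes χ^j - 1 decay geometrically in L²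
(`exists_integral_abs_chiPow_sub_one_le`).

For h = 1/(2n) the errors are found by duality with the square wave sign cos(2πnx), which is
orthogonal to `trigPoly n`. Its pairing with χ^p is F_p by Parseval (`integral_sqWave_mul_chiPow`),
which gives the lower bound. For equality when p ≥ 2 it suffices to find τ with χ^p - τ =
cos(2πnx)·Q and Q ≥ 0 (`exists_trigPoly_ae_eq`). In terms of coefficients, Q = ∑ q_m cos(2πmx) has
to satisfy (q_{k-n} + q_{k+n})/2 = sinc(πk/2n)^p for |k| ≥ n. The ansatz q_m = 2(2n/π)^p
cos(πm/2n)^p S(|m|) reduces this to S(m) + (-1)^p S(m+2n) = (m+n)^(-p), solved by the series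
`oddSeries`. This S is nonnegative and convex, hence has a nonnegative cosine series, and each
factor cos(πm/2n) averages two translates, which preserves nonnegativity. The exponents 0 and 1 are
elementary.

Finally F_j = 2∑ a_k^(j+1) with a_k = 2/(π(4k+1)), so ∑ F_j = 2∑ a_k/(1-a_k), which the partial
fractions of the cotangent evaluate as cot(π/4 - 1/2) = sec 1 + tan 1 (`hasSum_F`). -/

theorem ae_abs_le_essNorm {u : T → ℝ} (hu : MemLp u ⊤ volume) : ∀ᵐ x, |u x| ≤ essNorm u := by
  filter_upwards [ae_le_eLpNormEssSup (f := u) (μ := volume)] with x hx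
  have h2 := hu.2.ne
  rw [essNorm, eLpNorm_exponent_top] at *
  have := ENNReal.toReal_mono h2 hx
  simpa using this

theorem essNorm_nonneg (u : T → ℝ) : 0 ≤ essNorm u := ENNReal.toReal_nonneg

theorem eLpNorm_top_le_of_ae_abs_le {u : T → ℝ} {C : ℝ} (h : ∀ᵐ x, |u x| ≤ C) :
    eLpNorm u ⊤ volume ≤ ENNReal.ofReal C := by
  rw [eLpNorm_exponent_top]
  refine eLpNormEssSup_le_of_ae_bound ?_
  simpa using h

theorem essNorm_le {u : T → ℝ} {C : ℝ} (hC : 0 ≤ C) (h : ∀ᵐ x, |u x| ≤ C) : essNorm u ≤ C :=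
  ENNReal.toReal_le_of_le_ofReal hC (eLpNorm_top_le_of_ae_abs_le h)

theorem memLp_comp_sub_left {𝕜 : Type*} [NormedAddCommGroup 𝕜] {p : ENNReal} {u : T → 𝕜}
    (hu : MemLp u p volume) (x : T) : MemLp (fun t => u (x - t)) p volume :=
  hu.comp_measurePreserving (Measure.measurePreserving_sub_left volume x)

theorem essNorm_comp_sub_left {u : T → ℝ} (hu : MemLp u ⊤ volume) (x : T) :
    ∀ᵐ t, |u (x - t)| ≤ essNorm u := by
  have := (Measure.measurePreserving_sub_left (volume : Measure T) x).quasiMeasurePreserving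
  exact this.ae (p := fun y => |u y| ≤ essNorm u) (ae_abs_le_essNorm hu)

theorem convolutionExistsAt_of_memLp_top {𝕜 : Type*} [RCLike 𝕜] {u v : T → 𝕜}
    (hu : Integrable u) (hv : MemLp v ⊤ volume) (x : T) :
    ConvolutionExistsAt u v x (mul ℝ 𝕜) volume :=
  hu.mul_of_top_left (memLp_comp_sub_left hv x)

theorem integrable_mul_comp_sub {u v : T → ℝ} (hu : Integrable u) (hv : MemLp v ⊤ volume) (x : T) :
    Integrable fun t => u t * v (x - t) :=
  hu.mul_of_top_left (memLp_comp_sub_left hv x)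

theorem circConv_eq_convolution (u v : T → ℝ) : circConv u v = u ⋆[mul ℝ ℝ, volume] v := rfl

theorem abs_circConv_le {u v : T → ℝ} (hu : Integrable u) (hv : MemLp v ⊤ volume) (x : T) :
    |circConv u v x| ≤ (∫ t, |u t|) * essNorm v := by
  rw [circConv, ← integral_mul_const]
  refine (abs_integral_le_integral_abs).trans (integral_mono_ae
    (integrable_mul_comp_sub hu hv x).abs (hu.abs.mul_const _) ?_)
  filter_upwards [essNorm_comp_sub_left hv x] with t ht
  rw [abs_mul]
  gcongr

theorem memLp_top_circConv {u v : T → ℝ} (hu : Integrable u) (hv : MemLp v ⊤ volume) :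
    MemLp (circConv u v) ⊤ volume := by
  refine memLp_top_of_bound ?_ ((∫ t, |u t|) * essNorm v)
    (.of_forall fun x => abs_circConv_le hu hv x)
  exact (Integrable.integrable_convolution (mul ℝ ℝ) hu (hv.integrable le_top)).1

theorem convolution_assoc_of_memLp_top {𝕜 : Type*} [RCLike 𝕜] {u v w : T → 𝕜}
    (hu : MemLp u ⊤ volume) (hv : MemLp v ⊤ volume) (hw : MemLp w ⊤ volume) (x : T) :
    ((u ⋆[mul ℝ 𝕜, volume] v) ⋆[mul ℝ 𝕜, volume] w) x =
      (u ⋆[mul ℝ 𝕜, volume] (v ⋆[mul ℝ 𝕜, volume] w)) x := by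
  refine convolution_assoc _ _ _ _ (fun a b c => by simp [mul_assoc]) hu.1 hv.1 hw.1 ?_ ?_ ?_
  · exact .of_forall fun y => convolutionExistsAt_of_memLp_top (hu.integrable le_top) hv y
  · exact .of_forall fun y =>
      convolutionExistsAt_of_memLp_top (𝕜 := ℝ) (hv.integrable le_top).norm hw.norm y
  · exact convolutionExistsAt_of_memLp_top (𝕜 := ℝ) (hu.integrable le_top).norm
      (memLp_top_circConv (hv.integrable le_top).norm hw.norm) x

theorem circConv_assoc {u v w : T → ℝ} (hu : MemLp u ⊤ volume) (hv : MemLp v ⊤ volume)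
    (hw : MemLp w ⊤ volume) :
    circConv (circConv u v) w = circConv u (circConv v w) :=
  funext fun x => convolution_assoc_of_memLp_top hu hv hw x

theorem circConv_comm (u v : T → ℝ) : circConv u v = circConv v u := by
  funext x
  rw [circConv_eq_convolution, convolution_mul_swap]
  simp only [circConv, mul_comm]

theorem circConv_sub_right {u v w : T → ℝ} (hu : Integrable u) (hv : MemLp v ⊤ volume)
    (hw : MemLp w ⊤ volume) (x : T) :
    circConv u (fun y => v y - w y) x = circConv u v x - circConv u w x := by
  simp only [circConv, mul_sub]
  exact integral_sub (integrable_mul_comp_sub hu hv x) (integrable_mul_comp_sub hu hw x)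

theorem circConv_sub_left {u v w : T → ℝ} (hu : Integrable u) (hv : Integrable v)
    (hw : MemLp w ⊤ volume) (x : T) :
    circConv (fun y => u y - v y) w x = circConv u w x - circConv v w x := by
  simp only [circConv, sub_mul]
  exact integral_sub (integrable_mul_comp_sub hu hw x) (integrable_mul_comp_sub hv hw x)

theorem integral_circConv {u v : T → ℝ} (hu : Integrable u) (hv : Integrable v) :
    ∫ x, circConv u v x = (∫ x, u x) * ∫ x, v x := by
  have := integral_convolution (mul ℝ ℝ) hu hv
  exact this

theorem continuous_circConv {u v : T → ℝ} (hu : Integrable u) (hv : Continuous v) :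
    Continuous (circConv u v) := by
  refine BddAbove.continuous_convolution_right_of_integrable (mul ℝ ℝ) ?_ hu hv
  exact (isCompact_range hv.norm).bddAbove

/-! ### The kernel and its periodization -/

theorem chi_nonneg {h : ℝ} (hh : 0 < h) (x : ℝ) : 0 ≤ chi h x :=
  Set.indicator_nonneg (fun _ _ => by positivity) x

theorem measurable_chi (h : ℝ) : Measurable (chi h) :=
  measurable_const.indicator measurableSet_Ioo

theorem integrable_chi (h : ℝ) : Integrable (chi h) := by
  rw [chi, integrable_indicator_iff measurableSet_Ioo]
  exact integrableOn_const (by simp)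

theorem chiPer_nonneg {h : ℝ} (hh : 0 < h) (x : T) : 0 ≤ chiPer h x := by
  induction x using QuotientAddGroup.induction_on with
  | H x => exact tsum_nonneg fun j => chi_nonneg hh _

/-- An interval of length h contains at most h + 1 integers, and each contributes at most 1/h. -/
theorem chiPer_le {h : ℝ} (hh : 0 < h) (x : T) : chiPer h x ≤ (h + 1) / h := by
  induction x using QuotientAddGroup.induction_on with
  | H x =>
    change ∑' j : ℤ, chi h (x + j) ≤ _
    rw [tsum_eq_sum (s := Finset.Icc ⌈-h / 2 - x⌉ ⌊h / 2 - x⌋)]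
    · refine (Finset.sum_le_card_nsmul _ _ (1 / h) fun j _ => ?_).trans ?_
      · refine Set.indicator_le' (fun _ _ => le_rfl) (fun _ _ => ?_) _
        positivity
      · rw [nsmul_eq_mul, mul_one_div]
        gcongr
        rw [Int.card_Icc]
        rcases le_total 0 (⌊h / 2 - x⌋ + 1 - ⌈-h / 2 - x⌉) with h0 | h0
        · rw [← Int.cast_natCast, Int.toNat_of_nonneg h0]
          push_cast
          linarith [Int.floor_le (h / 2 - x), Int.le_ceil (-h / 2 - x)]
        · rw [Int.toNat_of_nonpos h0]
          push_cast
          linarith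
    · intro j hj
      refine Set.indicator_of_notMem (fun hx => hj ?_) _
      rw [Finset.mem_Icc, Int.ceil_le, Int.le_floor]
      constructor <;> linarith [hx.1, hx.2]

theorem measurable_chiPer {h : ℝ} (hh : 0 < h) : Measurable (chiPer h) := by
  have h1 : Measurable fun x : ℝ => ∑' j : ℤ, chi h (x + j) := by
    have : (fun x : ℝ => ∑' j : ℤ, chi h (x + j)) =
        fun x => (∑' j : ℤ, ENNReal.ofReal (chi h (x + j))).toReal := by
      funext x
      rw [ENNReal.tsum_toReal_eq fun _ => ENNReal.ofReal_ne_top]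
      exact tsum_congr fun j => (ENNReal.toReal_ofReal (chi_nonneg hh _)).symm
    rw [this]
    exact (Measurable.tsum fun j => ((measurable_chi h).comp
      (measurable_add_const _)).ennreal_ofReal).ennreal_toReal
  have h2 : chiPer h = (fun x : ℝ => ∑' j : ℤ, chi h (x + j)) ∘ Subtype.val ∘
      AddCircle.measurableEquivIoc 1 0 := by
    funext x
    exact congrArg (chiPer h) (AddCircle.coe_equivIoc (p := 1) (a := 0)).symm
  rw [h2]
  exact h1.comp (measurable_subtype_coe.comp (MeasurableEquiv.measurable _))

theorem memLp_top_chiPer {h : ℝ} (hh : 0 < h) : MemLp (chiPer h) ⊤ volume :=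
  memLp_top_of_bound (measurable_chiPer hh).aestronglyMeasurable ((h + 1) / h)
    (.of_forall fun x => by
      rw [Real.norm_of_nonneg (chiPer_nonneg hh x)]; exact chiPer_le hh x)

theorem automorphize_chi {𝕜 : Type*} [RCLike 𝕜] (h : ℝ) (x : T) :
    QuotientAddGroup.automorphize (Γ := AddSubgroup.zmultiples (1 : ℝ))
      (fun t : ℝ => (chi h t : 𝕜)) x = (chiPer h x : 𝕜) := by
  induction x using QuotientAddGroup.induction_on with
  | H x =>
    change ∑' a : (AddSubgroup.zmultiples (1 : ℝ)).op, ((chi h (a +ᵥ x) : ℝ) : 𝕜) =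
      ((∑' j : ℤ, chi h (x + j) : ℝ) : 𝕜)
    have hb : Function.Bijective fun n : ℤ =>
        (⟨AddOpposite.op (n : ℝ), ⟨n, by simp⟩⟩ : (AddSubgroup.zmultiples (1 : ℝ)).op) := by
      constructor
      · intro m n hmn
        simpa using hmn
      · rintro ⟨a, ⟨n, hn⟩⟩
        refine ⟨n, ?_⟩
        exact Subtype.ext (AddOpposite.unop_injective (by simpa using hn))
    rw [RCLike.ofReal_tsum]
    refine ((Equiv.ofBijective _ hb).tsum_eq _).symm.trans ?_
    exact tsum_congr fun j => rfl

/-- Unfolding the circle integral along ℝ → ℝ/ℤ. This turns the convolution over ℝ in `steklov` into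
`circConv`, and the Fourier coefficients of `chiPer` into integrals over (-h/2, h/2). -/
theorem integral_mul_chi {𝕜 : Type*} [RCLike 𝕜] {h : ℝ} (hh : 0 < h) {g : T → 𝕜}
    (hg : MemLp g ⊤ volume) :
    ∫ t : ℝ, g (t : T) * (chi h t : 𝕜) = ∫ t : T, g t * (chiPer h t : 𝕜) := by
  have hmap : Measure.map (QuotientAddGroup.mk : ℝ → T) (volume.restrict (Set.Ioc 0 (0 + 1))) =
      volume := (UnitAddCircle.measurePreserving_mk 0).map_eq
  have hF : QuotientAddGroup.automorphize (Γ := AddSubgroup.zmultiples (1 : ℝ))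
      (fun t : ℝ => (chi h t : 𝕜)) = fun x => (chiPer h x : 𝕜) := funext (automorphize_chi h)
  have := QuotientAddGroup.integral_mul_eq_integral_automorphize_mul
    (isAddFundamentalDomain_Ioc' (T := 1) one_pos 0)
    (f := fun t : ℝ => (chi h t : 𝕜)) (integrable_chi h).ofReal (g := g)
    (by rw [hmap]; exact hg.1)
    (by rw [hmap]; exact hg.2.ne)
    (by
      rw [hmap, hF]
      exact (RCLike.continuous_ofReal.measurable.comp
        (measurable_chiPer hh)).aestronglyMeasurable)
  rw [hmap, hF] at this
  exact this

theorem steklov_eq {h : ℝ} (hh : 0 < h) {g : T → ℝ} (hg : MemLp g ⊤ volume) :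
    steklov h g = circConv (chiPer h) g := by
  funext x
  have := integral_mul_chi hh (memLp_comp_sub_left hg x)
  simp only [RCLike.ofReal_real_eq_id, id] at this
  rw [steklov, this, circConv]
  simp only [mul_comm]

theorem integral_chi {h : ℝ} (hh : 0 < h) : ∫ t, chi h t = 1 := by
  rw [chi, integral_indicator measurableSet_Ioo, setIntegral_const]
  simp [measureReal_def, hh.le, hh.ne', neg_div]

theorem integral_chiPer {h : ℝ} (hh : 0 < h) : ∫ t, chiPer h t = 1 := by
  have := integral_mul_chi (𝕜 := ℝ) hh (memLp_const (1 : ℝ) (p := ⊤) (μ := (volume : Measure T)))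
  simpa [integral_chi hh] using this.symm

theorem memLp_top_chiPow {h : ℝ} (hh : 0 < h) : ∀ j, MemLp (chiPow h j) ⊤ volume
  | 0 => MemLp.zero
  | 1 => memLp_top_chiPer hh
  | j + 2 => memLp_top_circConv ((memLp_top_chiPer hh).integrable le_top)
      (memLp_top_chiPow hh (j + 1))

theorem integrable_chiPow {h : ℝ} (hh : 0 < h) (j : ℕ) : Integrable (chiPow h j) :=
  (memLp_top_chiPow hh j).integrable le_top

theorem integrable_chiPer {h : ℝ} (hh : 0 < h) : Integrable (chiPer h) :=
  (memLp_top_chiPer hh).integrable le_top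

theorem chiPow_nonneg {h : ℝ} (hh : 0 < h) : ∀ j x, 0 ≤ chiPow h j x
  | 0, _ => le_rfl
  | 1, x => chiPer_nonneg hh x
  | j + 2, _ => integral_nonneg fun t =>
      mul_nonneg (chiPer_nonneg hh t) (chiPow_nonneg hh (j + 1) _)

theorem integral_chiPow {h : ℝ} (hh : 0 < h) : ∀ j, ∫ x, chiPow h (j + 1) x = 1
  | 0 => integral_chiPer hh
  | j + 1 => by
    change ∫ x, circConv (chiPer h) (chiPow h (j + 1)) x = 1
    rw [integral_circConv (integrable_chiPer hh) (integrable_chiPow hh _), integral_chiPer hh,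
      integral_chiPow hh j, one_mul]

/-! ### Fourier coefficients and Parseval's identity. -/

theorem haarAddCircle_eq_volume : (AddCircle.haarAddCircle : Measure T) = volume := by
  have := AddCircle.volume_eq_smul_haarAddCircle (T := 1)
  simpa using this.symm

theorem fourierCoeff_eq_integral (u : T → ℂ) (k : ℤ) :
    fourierCoeff u k = ∫ t : T, fourier (-k) t * u t := by
  rw [fourierCoeff, haarAddCircle_eq_volume]
  rfl

theorem memLp_top_fourier (k : ℤ) : MemLp (fun x : T => (fourier k x : ℂ)) ⊤ volume :=
  memLp_top_of_bound (map_continuous _).aestronglyMeasurable 1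
    (.of_forall fun x => by rw [fourier_apply, Circle.norm_coe])

theorem convolution_const_mul_fourier (u : T → ℂ) (c : ℂ) (k : ℤ) (x : T) :
    (u ⋆[mul ℝ ℂ, volume] fun y => c * fourier k y) x = c * fourierCoeff u k * fourier k x := by
  rw [fourierCoeff_eq_integral, mul_assoc, ← integral_mul_const, ← integral_const_mul]
  refine integral_congr_ae (.of_forall fun t => ?_)
  simp only [ContinuousLinearMap.mul_apply', fourier_apply, sub_eq_add_neg, smul_add, neg_smul,
    smul_neg, AddCircle.toCircle_add, Circle.coe_mul]
  ring

theorem convolution_fourier (u : T → ℂ) (k : ℤ) (x : T) :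
    (u ⋆[mul ℝ ℂ, volume] fun y => fourier k y) x = fourierCoeff u k * fourier k x := by
  simpa using convolution_const_mul_fourier u 1 k x

/-- Characters are eigenfunctions of convolution, so associativity applied to u, v and a character,
evaluated at 0, gives the product formula. -/
theorem fourierCoeff_circConv {u v : T → ℝ} (hu : MemLp u ⊤ volume) (hv : MemLp v ⊤ volume)
    (k : ℤ) : fourierCoeff (fun x => (circConv u v x : ℂ)) k =
      fourierCoeff (fun x => (u x : ℂ)) k * fourierCoeff (fun x => (v x : ℂ)) k := by
  have h0 : (fun x => (circConv u v x : ℂ)) =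
      (fun x => (u x : ℂ)) ⋆[mul ℝ ℂ, volume] fun x => (v x : ℂ) := by
    funext x
    rw [circConv, ← integral_complex_ofReal]
    refine integral_congr_ae (.of_forall fun t => ?_)
    simp
  have h1 := convolution_assoc_of_memLp_top (MemLp.ofReal (K := ℂ) hu) (MemLp.ofReal (K := ℂ) hv)
    (memLp_top_fourier k) 0
  have h2 : ((fun x => (v x : ℂ)) ⋆[mul ℝ ℂ, volume] fun y => (fourier k y : ℂ)) =
      fun y => fourierCoeff (fun x => (v x : ℂ)) k * (fourier k y : ℂ) :=
    funext fun x => convolution_fourier _ k x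
  simp only [RCLike.ofReal_eq_complex_ofReal] at h1
  rw [h2, convolution_const_mul_fourier, convolution_fourier,
    show (fourier k (0 : T) : ℂ) = 1 by simp, mul_one, mul_one, ← h0] at h1
  rw [h1, mul_comm]

theorem intervalIntegral_fourier_neg (h : ℝ) (k : ℤ) :
    ∫ t : ℝ in (-h / 2)..(h / 2), (fourier (-k) (t : T) : ℂ) =
      (h * sinc (Real.pi * k * h) : ℝ) := by
  have h2 : ∀ t : ℝ, (fourier (-k) (t : T) : ℂ) =
      Complex.exp (((-(2 * Real.pi * k) * t : ℝ) : ℂ) * Complex.I) := by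
    intro t
    rw [fourier_coe_apply]
    push_cast
    congr 1
    ring
  simp_rw [h2]
  rcases eq_or_ne k 0 with rfl | hk
  · simp
    ring
  · have hk' : (-(2 * Real.pi * k) : ℝ) ≠ 0 := by
      have : (k : ℝ) ≠ 0 := by exact_mod_cast hk
      have := Real.pi_ne_zero
      simp [*]
    rw [intervalIntegral.integral_comp_mul_left
      (fun t : ℝ => Complex.exp (t * Complex.I)) hk', intervalIntegral.integral_symm,
      show -(2 * Real.pi * k) * (h / 2) = -(Real.pi * k * h) by ring,
      show -(2 * Real.pi * k) * (-h / 2) = Real.pi * k * h by ring,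
      integral_exp_mul_I_eq_sinc]
    have : (k : ℂ) ≠ 0 := by exact_mod_cast hk
    have : (Real.pi : ℂ) ≠ 0 := by exact_mod_cast Real.pi_ne_zero
    simp only [Complex.real_smul]
    push_cast
    field_simp

theorem fourierCoeff_chiPer {h : ℝ} (hh : 0 < h) (k : ℤ) :
    fourierCoeff (fun x => (chiPer h x : ℂ)) k = (sinc (Real.pi * k * h) : ℂ) := by
  have h1 := integral_mul_chi hh (memLp_top_fourier (-k))
  rw [fourierCoeff_eq_integral]
  refine h1.symm.trans ?_
  have h2 : ∀ t : ℝ, (fourier (-k) (t : T) : ℂ) * ((chi h t : ℝ) : ℂ) =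
      (Set.Ioo (-h / 2) (h / 2)).indicator
        (fun t : ℝ => (fourier (-k) (t : T) : ℂ) * (1 / h)) t := by
    intro t
    rw [chi]
    by_cases ht : t ∈ Set.Ioo (-h / 2) (h / 2)
    · rw [Set.indicator_of_mem ht, Set.indicator_of_mem ht]
      push_cast
      rfl
    · rw [Set.indicator_of_notMem ht, Set.indicator_of_notMem ht]
      simp
  change ∫ t : ℝ, (fourier (-k) (t : T) : ℂ) * ((chi h t : ℝ) : ℂ) = _
  simp_rw [h2]
  rw [integral_indicator measurableSet_Ioo, ← integral_Ioc_eq_integral_Ioo,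
    ← intervalIntegral.integral_of_le (by linarith), intervalIntegral.integral_mul_const,
    intervalIntegral_fourier_neg]
  have : (h : ℂ) ≠ 0 := by exact_mod_cast hh.ne'
  push_cast
  field_simp

theorem fourierCoeff_chiPow {h : ℝ} (hh : 0 < h) (k : ℤ) : ∀ j : ℕ,
    fourierCoeff (fun x => (chiPow h (j + 1) x : ℂ)) k =
      ((sinc (Real.pi * k * h) ^ (j + 1) : ℝ) : ℂ)
  | 0 => by
    rw [zero_add, pow_one]
    exact fourierCoeff_chiPer hh k
  | j + 1 => by
    have := fourierCoeff_circConv (memLp_top_chiPer hh) (memLp_top_chiPow hh (j + 1)) k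
    rw [fourierCoeff_chiPow hh k j, fourierCoeff_chiPer hh] at this
    rw [pow_succ']
    push_cast at this ⊢
    exact this

theorem ae_eq_of_fourierCoeff_eq {u v : T → ℂ} (hu : MemLp u 2 volume) (hv : MemLp v 2 volume)
    (h : ∀ k, fourierCoeff u k = fourierCoeff v k) : u =ᵐ[volume] v := by
  rw [← haarAddCircle_eq_volume] at *
  have : hu.toLp = hv.toLp := by
    refine (fourierBasis (T := 1)).repr.injective ?_
    ext k
    rw [fourierBasis_repr, fourierBasis_repr, fourierCoeff_congr_ae hu.coeFn_toLp,
      fourierCoeff_congr_ae hv.coeFn_toLp, h]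
  exact (MemLp.toLp_eq_toLp_iff hu hv).1 this

theorem hasSum_conj_fourierCoeff_mul {u v : T → ℂ} (hu : MemLp u 2 volume)
    (hv : MemLp v 2 volume) :
    HasSum (fun k => conj (fourierCoeff u k) * fourierCoeff v k) (∫ x, conj (u x) * v x) := by
  rw [← haarAddCircle_eq_volume] at *
  have h1 := (fourierBasis (T := 1)).hasSum_inner_mul_inner hu.toLp hv.toLp
  have h2 : inner ℂ hu.toLp hv.toLp = ∫ x, conj (u x) * v x ∂AddCircle.haarAddCircle := by
    rw [L2.inner_def]
    refine integral_congr_ae ?_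
    filter_upwards [hu.coeFn_toLp, hv.coeFn_toLp] with x hx hx'
    rw [hx, hx', RCLike.inner_apply, mul_comm]
  rw [h2] at h1
  refine h1.congr_fun fun k => ?_
  rw [← HilbertBasis.repr_apply_apply, fourierBasis_repr, fourierCoeff_congr_ae hv.coeFn_toLp,
    ← inner_conj_symm, ← HilbertBasis.repr_apply_apply, fourierBasis_repr,
    fourierCoeff_congr_ae hu.coeFn_toLp]

theorem fourierCoeff_fourier_self (k l : ℤ) :
    fourierCoeff (fun x : T => (fourier k x : ℂ)) l = if l = k then 1 else 0 := by
  have := congrFun (fourierCoeff_fourier (T := 1) k) l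
  rw [this, Pi.single_apply]

theorem fourierCoeff_const (c : ℂ) (l : ℤ) :
    fourierCoeff (fun _ : T => c) l = if l = 0 then c else 0 := by
  have h := fourierCoeff.const_smul (fun x : T => (fourier 0 x : ℂ)) c l
  rw [fourierCoeff_fourier_self] at h
  simpa [Pi.smul_def] using h

theorem fourierCoeff_sub {u v : T → ℂ} (hu : Integrable u) (hv : Integrable v) (k : ℤ) :
    fourierCoeff (fun x => u x - v x) k = fourierCoeff u k - fourierCoeff v k := by
  simp only [fourierCoeff_eq_integral, mul_sub]
  exact integral_sub (hu.mul_of_top_right (memLp_top_fourier (-k)))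
    (hv.mul_of_top_right (memLp_top_fourier (-k)))

/-! ### Trigonometric polynomials -/

/-- The function `cos (2πkx)` on the circle. -/
def cosT (k : ℤ) : C(T, ℝ) := ⟨fun x => (fourier k x : ℂ).re, by fun_prop⟩

/-- The function `sin (2πkx)` on the circle. -/
def sinT (k : ℤ) : C(T, ℝ) := ⟨fun x => (fourier k x : ℂ).im, by fun_prop⟩

theorem fourier_coe_eq_exp (k : ℤ) (x : ℝ) :
    (fourier k (x : T) : ℂ) = Complex.exp ((2 * Real.pi * k * x : ℝ) * Complex.I) := by
  rw [fourier_coe_apply]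
  push_cast
  congr 1
  ring

theorem cosT_coe (k : ℤ) (x : ℝ) : cosT k (x : T) = Real.cos (2 * Real.pi * k * x) := by
  change (fourier k (x : T) : ℂ).re = _
  rw [fourier_coe_eq_exp, Complex.exp_ofReal_mul_I_re]

theorem sinT_coe (k : ℤ) (x : ℝ) : sinT k (x : T) = Real.sin (2 * Real.pi * k * x) := by
  change (fourier k (x : T) : ℂ).im = _
  rw [fourier_coe_eq_exp, Complex.exp_ofReal_mul_I_im]

theorem cosT_sub (k : ℤ) (x y : T) :
    cosT k (x - y) = cosT k x * cosT k y + sinT k x * sinT k y := by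
  induction x using QuotientAddGroup.induction_on with
  | H x =>
    induction y using QuotientAddGroup.induction_on with
    | H y =>
      change cosT k ((x - y : ℝ) : T) = _
      rw [cosT_coe, mul_sub, Real.cos_sub]
      simp only [← cosT_coe, ← sinT_coe]

theorem sinT_sub (k : ℤ) (x y : T) :
    sinT k (x - y) = sinT k x * cosT k y - cosT k x * sinT k y := by
  induction x using QuotientAddGroup.induction_on with
  | H x =>
    induction y using QuotientAddGroup.induction_on with
    | H y =>
      change sinT k ((x - y : ℝ) : T) = _
      rw [sinT_coe, mul_sub, Real.sin_sub]
      simp only [← cosT_coe, ← sinT_coe]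

theorem cosT_zero (x : T) : cosT 0 x = 1 := by
  change (fourier 0 x : ℂ).re = 1
  simp

theorem sinT_zero (x : T) : sinT 0 x = 0 := by
  change (fourier 0 x : ℂ).im = 0
  simp

/-- The sine sum may start at j = 0, where the sine vanishes; with a common index range the addition
formulas act term by term. -/
theorem mem_trigPoly_iff {n : ℕ} {τ : C(T, ℝ)} :
    τ ∈ trigPoly n ↔ ∃ a b : ℕ → ℝ, ∀ x : T, τ x =
      ∑ j ∈ Finset.range n, (a j * cosT j x + b j * sinT j x) := by
  have key : ∀ (a b : ℕ → ℝ) (x : ℝ),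
      ∑ j ∈ Finset.range n, a j * Real.cos (2 * Real.pi * j * x) +
        ∑ j ∈ Finset.Ico 1 n, b j * Real.sin (2 * Real.pi * j * x) =
      ∑ j ∈ Finset.range n, (a j * cosT j (x : T) + b j * sinT j (x : T)) := by
    intro a b x
    rw [Finset.sum_add_distrib]
    congr 1
    · exact Finset.sum_congr rfl fun j _ => by rw [cosT_coe]; push_cast; rfl
    · rw [Finset.range_eq_Ico]
      rcases Nat.eq_zero_or_pos n with rfl | hn
      · simp
      · rw [Finset.sum_eq_sum_Ico_succ_bot hn, Nat.cast_zero, sinT_zero, mul_zero, zero_add]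
        exact Finset.sum_congr rfl fun j _ => by rw [sinT_coe]; push_cast; rfl
  constructor
  · rintro ⟨a, b, h⟩
    refine ⟨a, b, fun x => ?_⟩
    induction x using QuotientAddGroup.induction_on with
    | H x => exact (h x).trans (key a b x)
  · rintro ⟨a, b, h⟩
    exact ⟨a, b, fun x => (h x).trans (key a b x).symm⟩

/-- This reflection invariance is what turns orthogonality to `trigPoly n` into τ ⊙ g = 0. -/
theorem comp_sub_left_mem_trigPoly {n : ℕ} {τ : C(T, ℝ)} (hτ : τ ∈ trigPoly n) (x : T) :
    τ.comp ⟨fun s : T => x - s, by fun_prop⟩ ∈ trigPoly n := by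
  obtain ⟨a, b, h⟩ := mem_trigPoly_iff.1 hτ
  refine mem_trigPoly_iff.2 ⟨fun j => a j * cosT j x + b j * sinT j x,
    fun j => a j * sinT j x - b j * cosT j x, fun s => ?_⟩
  change τ (x - s) = _
  rw [h]
  refine Finset.sum_congr rfl fun j _ => ?_
  rw [cosT_sub, sinT_sub]
  ring

theorem const_mem_trigPoly {n : ℕ} (hn : 1 ≤ n) (c : ℝ) :
    ContinuousMap.const T c ∈ trigPoly n := by
  refine mem_trigPoly_iff.2 ⟨fun j => if j = 0 then c else 0, 0, fun x => ?_⟩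
  rw [Finset.sum_eq_single 0]
  · simp [cosT_zero]
  · intro j _ hj
    simp [hj]
  · intro h
    exact absurd (Finset.mem_range.2 hn) h

theorem memLp_top_continuousMap (f : C(T, ℝ)) : MemLp f ⊤ volume :=
  memLp_top_of_bound f.continuous.aestronglyMeasurable ‖f‖ (.of_forall f.norm_coe_le_norm)

theorem integrable_continuousMap (f : C(T, ℝ)) : Integrable f :=
  (memLp_top_continuousMap f).integrable le_top

theorem essNorm_continuousMap_le (f : C(T, ℝ)) : essNorm f ≤ ‖f‖ :=
  essNorm_le (norm_nonneg _) (.of_forall f.norm_coe_le_norm)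

theorem exists_mem_trigPoly_circConv {n : ℕ} {τ : C(T, ℝ)} (hτ : τ ∈ trigPoly n) {u : T → ℝ}
    (hu : Integrable u) : ∃ σ ∈ trigPoly n, ∀ x, circConv τ u x = σ x := by
  obtain ⟨a, b, h⟩ := mem_trigPoly_iff.1 hτ
  have hint : ∀ f : C(T, ℝ), Integrable fun t => u t * f t := fun f =>
    hu.mul_of_top_left (memLp_top_continuousMap f)
  have key : ∀ x, circConv τ u x = ∑ j ∈ Finset.range n,
      ((a j * (∫ t, u t * cosT j t) - b j * ∫ t, u t * sinT j t) * cosT j x +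
        (a j * (∫ t, u t * sinT j t) + b j * ∫ t, u t * cosT j t) * sinT j x) := by
    intro x
    rw [circConv_comm, circConv]
    have : ∀ t, u t * τ (x - t) = ∑ j ∈ Finset.range n,
        ((a j * cosT j x + b j * sinT j x) * (u t * cosT j t) +
          (a j * sinT j x - b j * cosT j x) * (u t * sinT j t)) := by
      intro t
      rw [h, Finset.mul_sum]
      refine Finset.sum_congr rfl fun j _ => ?_
      rw [cosT_sub, sinT_sub]
      ring
    simp_rw [this]
    rw [integral_finsetSum _ fun (j : ℕ) _ => by
      exact ((hint (cosT j)).const_mul _).add ((hint (sinT j)).const_mul _)]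
    refine Finset.sum_congr rfl fun j _ => ?_
    rw [integral_add ((hint _).const_mul _) ((hint _).const_mul _), integral_const_mul,
      integral_const_mul]
    ring
  refine ⟨∑ j ∈ Finset.range n,
    ((a j * (∫ t, u t * cosT j t) - b j * ∫ t, u t * sinT j t) • cosT j +
        (a j * (∫ t, u t * sinT j t) + b j * ∫ t, u t * cosT j t) • sinT j),
    mem_trigPoly_iff.2 ⟨fun j => a j * (∫ t, u t * cosT j t) - b j * ∫ t, u t * sinT j t,
      fun j => a j * (∫ t, u t * sinT j t) + b j * ∫ t, u t * cosT j t, fun x => ?_⟩, fun x => ?_⟩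
  · simp [ContinuousMap.sum_apply]
  · rw [key]
    simp [ContinuousMap.sum_apply]

theorem circConv_eq_zero_of_isPerp {n : ℕ} {g : T → ℝ} (hg : IsPerp n g) {τ : C(T, ℝ)}
    (hτ : τ ∈ trigPoly n) (x : T) : circConv τ g x = 0 := by
  rw [circConv_comm]
  exact hg.2 _ (comp_sub_left_mem_trigPoly hτ x)

/-! ### Best approximation -/

theorem bestL1_nonneg (n : ℕ) (φ : T → ℝ) : 0 ≤ bestL1 n φ :=
  Real.iInf_nonneg fun _ => integral_nonneg fun _ => abs_nonneg _

theorem bestL1_le {n : ℕ} (φ : T → ℝ) {τ : C(T, ℝ)} (hτ : τ ∈ trigPoly n) :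
    bestL1 n φ ≤ ∫ x, |φ x - τ x| :=
  ciInf_le (f := fun τ : trigPoly n => ∫ x, |φ x - (τ : C(T, ℝ)) x|)
    ⟨0, by rintro _ ⟨τ, rfl⟩; exact integral_nonneg fun _ => abs_nonneg _⟩ ⟨τ, hτ⟩

theorem bestUnif_le {n : ℕ} (f : C(T, ℝ)) {τ : C(T, ℝ)} (hτ : τ ∈ trigPoly n) :
    bestUnif n f ≤ ‖f - τ‖ :=
  ciInf_le (f := fun τ : trigPoly n => ‖f - (τ : C(T, ℝ))‖)
    ⟨0, by rintro _ ⟨τ, rfl⟩; exact norm_nonneg _⟩ ⟨τ, hτ⟩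

theorem bestUnif_le_norm (n : ℕ) (f : C(T, ℝ)) : bestUnif n f ≤ ‖f‖ := by
  simpa using bestUnif_le f (trigPoly n).zero_mem

theorem bestUnif_add_le (n : ℕ) (f g : C(T, ℝ)) :
    bestUnif n (f + g) ≤ bestUnif n f + bestUnif n g := by
  refine le_ciInf_add_ciInf fun σ τ => ?_
  refine (bestUnif_le _ ((trigPoly n).add_mem σ.2 τ.2)).trans ?_
  rw [add_sub_add_comm]
  exact norm_add_le _ _

/-- Subtracting τ from φ does not change the convolution with g, so the L¹ bound may be minimized
over τ. -/
theorem abs_circConv_le_bestL1_mul {n : ℕ} {φ g : T → ℝ} (hφ : Integrable φ) (hg : IsPerp n g)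
    (x : T) : |circConv φ g x| ≤ bestL1 n φ * essNorm g := by
  rw [bestL1, Real.iInf_mul_of_nonneg (essNorm_nonneg g)]
  refine le_ciInf fun τ => ?_
  have hτ := integrable_continuousMap (τ : C(T, ℝ))
  have h1 := circConv_sub_left hφ hτ hg.1 x
  rw [circConv_eq_zero_of_isPerp hg τ.2, sub_zero] at h1
  rw [← h1]
  exact abs_circConv_le (hφ.sub hτ) hg.1 x

theorem essNorm_circConv_le {n : ℕ} {φ g : T → ℝ} (hφ : Integrable φ) (hg : IsPerp n g) :
    essNorm (circConv φ g) ≤ bestL1 n φ * essNorm g :=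
  essNorm_le (mul_nonneg (bestL1_nonneg _ _) (essNorm_nonneg _))
    (.of_forall fun x => abs_circConv_le_bestL1_mul hφ hg x)

/-- The convolution of an integrable with a continuous function, as a continuous function. -/
def circConvC {φ : T → ℝ} (hφ : Integrable φ) (u : C(T, ℝ)) : C(T, ℝ) :=
  ⟨circConv φ u, continuous_circConv hφ u.continuous⟩

/-- Here τ ⊙ u need not vanish, but it is a trigonometric polynomial and so is admissible as an
approximant of φ ⊙ u. -/
theorem bestUnif_circConvC_le {n : ℕ} {φ : T → ℝ} (hφ : Integrable φ) (u : C(T, ℝ)) :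
    bestUnif n (circConvC hφ u) ≤ bestL1 n φ * ‖u‖ := by
  rw [bestL1, Real.iInf_mul_of_nonneg (norm_nonneg u)]
  refine le_ciInf fun τ => ?_
  have hτ := integrable_continuousMap (τ : C(T, ℝ))
  obtain ⟨σ, hσ, h⟩ := exists_mem_trigPoly_circConv τ.2 (integrable_continuousMap u)
  refine (bestUnif_le _ hσ).trans ?_
  refine (ContinuousMap.norm_le _ (by positivity)).2 fun x => ?_
  change |circConv φ u x - σ x| ≤ _
  rw [← h, ← circConv_sub_left hφ hτ (memLp_top_continuousMap u)]
  refine (abs_circConv_le (hφ.sub hτ) (memLp_top_continuousMap u) x).trans ?_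
  have := essNorm_continuousMap_le u
  exact mul_le_mul_of_nonneg_left this (integral_nonneg fun _ => abs_nonneg _)

/-! ### The error for the Dirac measure. -/

theorem totalVariation_toSignedMeasure (μ : Measure T) [IsFiniteMeasure μ] :
    μ.toSignedMeasure.totalVariation = μ := by
  have : μ.toSignedMeasure.toJordanDecomposition =
      { posPart := μ, negPart := 0, mutuallySingular := Measure.MutuallySingular.zero_right } := by
    refine (JordanDecomposition.toSignedMeasure_injective ?_)
    rw [SignedMeasure.toSignedMeasure_toJordanDecomposition, JordanDecomposition.toSignedMeasure]
    simp
  rw [SignedMeasure.totalVariation, this]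
  simp

/-- The point 0 is Lebesgue null, so subtracting a density leaves its mass 1 intact; τ = 0 attains
this bound. -/
theorem bestTV_dirac (n : ℕ) : bestTV n (Measure.dirac (0 : T)).toSignedMeasure = 1 := by
  apply le_antisymm
  · refine (ciInf_le (f := fun τ : trigPoly n => _)
      ⟨0, by rintro _ ⟨τ, rfl⟩; exact ENNReal.toReal_nonneg⟩ 0).trans ?_
    simp [totalVariation_toSignedMeasure]
  · refine le_ciInf fun τ => ?_
    set s := (Measure.dirac (0 : T)).toSignedMeasure -
      (volume : Measure T).withDensityᵥ ((τ : C(T, ℝ)) : T → ℝ) with hs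
    have h0 : s {0} = 1 := by
      rw [hs, _root_.sub_apply, Measure.toSignedMeasure_apply_measurable
        (measurableSet_singleton _), withDensityᵥ_apply (integrable_continuousMap _)
        (measurableSet_singleton _), Measure.restrict_singleton]
      have hv : (volume : Measure T) {0} = 0 := by
        have := AddCircle.volume_closedBall (T := 1) (x := 0) 0
        simpa using this
      simp [measureReal_def, hv]
    have h1 := s.norm_le_totalVariation {0}
    rw [h0] at h1
    have h2 : s.totalVariation.real {0} ≤ s.totalVariation.real Set.univ :=
      measureReal_mono (Set.subset_univ _)
    simpa [measureReal_def] using h1.trans h2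

/-! ### Summability of the errors of best approximation -/

theorem exists_abs_sinc_le {h : ℝ} (hh : 0 < h) :
    ∃ ρ : ℝ, 0 < ρ ∧ ρ < 1 ∧ ∀ k : ℤ, k ≠ 0 → |sinc (Real.pi * k * h)| ≤ ρ := by
  have hlt : ∀ k : ℤ, k ≠ 0 → |sinc (Real.pi * k * h)| < 1 := by
    intro k hk
    have hy : Real.pi * k * h ≠ 0 := by
      have : (k : ℝ) ≠ 0 := by exact_mod_cast hk
      have := Real.pi_ne_zero
      have := hh.ne'
      positivity
    rw [Real.sinc_of_ne_zero hy, abs_div, div_lt_one (abs_pos.2 hy)]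
    exact Real.abs_sin_lt_abs hy
  have hsum := hasSum_conj_fourierCoeff_mul
    ((MemLp.ofReal (K := ℂ) (memLp_top_chiPer hh)).mono_exponent (p := 2) le_top)
    ((MemLp.ofReal (K := ℂ) (memLp_top_chiPer hh)).mono_exponent (p := 2) le_top)
  simp only [RCLike.ofReal_eq_complex_ofReal, fourierCoeff_chiPer hh, Complex.conj_ofReal,
    ← Complex.ofReal_mul] at hsum
  have hz := (Complex.summable_ofReal.1 hsum.summable).tendsto_cofinite_zero
  -- By Parseval for `chiPer` the squares are summable, so only finitely many frequencies have
  -- |sinc| ≥ 1/2. On the nonzero ones among these |sinc| < 1, hence any ρ close enough to 1 from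
  -- below works.
  have hfin : {k : ℤ | ¬ sinc (Real.pi * k * h) * sinc (Real.pi * k * h) < 1 / 4}.Finite :=
    eventually_cofinite.1 (hz.eventually (gt_mem_nhds (by norm_num)))
  have hev : ∀ᶠ ρ : ℝ in 𝓝[<] 1, 1 / 2 < ρ ∧ ρ < 1 ∧
      ∀ k ∈ {k : ℤ | ¬ sinc (Real.pi * k * h) * sinc (Real.pi * k * h) < 1 / 4},
        k ≠ 0 → |sinc (Real.pi * k * h)| ≤ ρ := by
    have e1 : ∀ᶠ ρ : ℝ in 𝓝[<] 1, 1 / 2 < ρ :=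
      nhdsWithin_le_nhds (lt_mem_nhds (by norm_num))
    have e2 : ∀ᶠ ρ : ℝ in 𝓝[<] 1, ρ < 1 := self_mem_nhdsWithin
    refine e1.and (e2.and ((eventually_all_finite hfin).2 fun k _ => ?_))
    rcases eq_or_ne k 0 with rfl | hk
    · simp
    · filter_upwards [nhdsWithin_le_nhds (lt_mem_nhds (hlt k hk))] with ρ hρ _ using hρ.le
  obtain ⟨ρ, h1, h2, h3⟩ := hev.exists
  refine ⟨ρ, by linarith, h2, fun k hk => ?_⟩
  by_cases hk' : sinc (Real.pi * k * h) * sinc (Real.pi * k * h) < 1 / 4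
  · refine le_trans ?_ h1.le
    rw [← pow_two] at hk'
    exact abs_le_of_sq_le_sq (by nlinarith) (by norm_num)
  · exact h3 k hk' hk

/-- Subtracting 1 removes the frequency 0. Every other coefficient of the power j + 1 is at most ρ^j
times that of the first power, so Parseval bounds the L² norm by a multiple of ρ^j. -/
theorem exists_integral_abs_chiPow_sub_one_le {h : ℝ} (hh : 0 < h) :
    ∃ C ρ : ℝ, 0 < ρ ∧ ρ < 1 ∧ ∀ j : ℕ, ∫ x, |chiPow h (j + 1) x - 1| ≤ C * ρ ^ j := by
  obtain ⟨ρ, hρ, hρ1, hs⟩ := exists_abs_sinc_le hh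
  have hP : ∀ j : ℕ, MemLp (fun x => chiPow h (j + 1) x - 1) ⊤ volume := fun j =>
    (memLp_top_chiPow hh (j + 1)).sub (memLp_const _)
  have hsq : ∀ j : ℕ, HasSum (fun k : ℤ => if k = 0 then 0 else
      (sinc (Real.pi * k * h) ^ (j + 1)) ^ 2) (∫ x, (chiPow h (j + 1) x - 1) ^ 2) := by
    intro j
    have h1 := (MemLp.ofReal (K := ℂ) (hP j)).mono_exponent (p := 2) le_top
    have h2 := hasSum_conj_fourierCoeff_mul h1 h1
    simp only [RCLike.ofReal_eq_complex_ofReal, Complex.conj_ofReal, ← Complex.ofReal_mul,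
      integral_complex_ofReal] at h2
    rw [← Complex.hasSum_ofReal]
    simp only [← pow_two] at h2
    refine h2.congr_fun fun k => ?_
    have h3 : fourierCoeff (fun x => ((chiPow h (j + 1) x - 1 : ℝ) : ℂ)) k =
        ((if k = 0 then 0 else sinc (Real.pi * k * h) ^ (j + 1) : ℝ) : ℂ) := by
      have h4 := fourierCoeff_sub (integrable_chiPow hh (j + 1)).ofReal
        (integrable_const (1 : ℂ)) k
      simp only [RCLike.ofReal_eq_complex_ofReal] at h4
      simp only [Complex.ofReal_sub, Complex.ofReal_one]
      rw [h4, fourierCoeff_const, fourierCoeff_chiPow hh]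
      split_ifs with hk
      · simp [hk]
      · simp
    rw [h3, Complex.conj_ofReal, ← Complex.ofReal_mul]
    split_ifs with hk
    · simp
    · rw [pow_two]
  set S := ∫ x, (chiPow h (0 + 1) x - 1) ^ 2
  have hle : ∀ j : ℕ, ∫ x, (chiPow h (j + 1) x - 1) ^ 2 ≤ (ρ ^ j) ^ 2 * S := by
    intro j
    refine hasSum_le (fun k => ?_) (hsq j) ((hsq 0).mul_left _)
    split_ifs with hk
    · simp
    · have h1 : |sinc (Real.pi * k * h) ^ (j + 1)| ≤ ρ ^ j * |sinc (Real.pi * k * h)| := by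
        rw [abs_pow, pow_succ]
        have := hs k hk
        gcongr
      have h2 := pow_le_pow_left₀ (abs_nonneg _) h1 2
      rw [sq_abs, mul_pow, sq_abs] at h2
      simpa using h2
  refine ⟨(S + 1) / 2, ρ, hρ, hρ1, fun j => ?_⟩
  have hρj : 0 < ρ ^ j := pow_pos hρ j
  have hint : Integrable fun x => (chiPow h (j + 1) x - 1) ^ 2 :=
    ((hP j).mono_exponent (p := 2) le_top).integrable_sq
  -- From L² to L¹ by 2|a| ≤ a²/ρ^j + ρ^j, with the weight matched to the decay rate.
  calc ∫ x, |chiPow h (j + 1) x - 1|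
      ≤ ∫ x, ((chiPow h (j + 1) x - 1) ^ 2 * (ρ ^ j)⁻¹ + ρ ^ j) * (1 / 2) := by
        refine integral_mono ((hP j).integrable le_top).abs
          (((hint.mul_const _).add (integrable_const _)).mul_const _) fun x => ?_
        have h1 := sq_nonneg (|chiPow h (j + 1) x - 1| - ρ ^ j)
        rw [sub_sq, sq_abs] at h1
        have h2 : (chiPow h (j + 1) x - 1) ^ 2 * (ρ ^ j)⁻¹ + ρ ^ j =
            ((chiPow h (j + 1) x - 1) ^ 2 + (ρ ^ j) ^ 2) / ρ ^ j := by field_simp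
        change _ ≤ ((chiPow h (j + 1) x - 1) ^ 2 * (ρ ^ j)⁻¹ + ρ ^ j) * (1 / 2)
        rw [h2, mul_one_div, le_div_iff₀ two_pos, le_div_iff₀ hρj]
        linarith
    _ = ((∫ x, (chiPow h (j + 1) x - 1) ^ 2) * (ρ ^ j)⁻¹ + ρ ^ j) * (1 / 2) := by
        rw [integral_mul_const, integral_add (hint.mul_const _) (integrable_const _),
          integral_mul_const]
        simp [measureReal_def]
    _ ≤ ((ρ ^ j) ^ 2 * S * (ρ ^ j)⁻¹ + ρ ^ j) * (1 / 2) := by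
        have := hle j
        gcongr
    _ = (S + 1) / 2 * ρ ^ j := by field_simp

theorem chiErr_nonneg (n : ℕ) (h : ℝ) : ∀ j, 0 ≤ chiErr n h j
  | 0 => by rw [chiErr, bestTV_dirac]; exact zero_le_one
  | _ + 1 => bestL1_nonneg _ _

theorem summable_chiErr {n : ℕ} (hn : 1 ≤ n) {h : ℝ} (hh : 0 < h) : Summable (chiErr n h) := by
  obtain ⟨C, ρ, hρ, hρ1, hC⟩ := exists_integral_abs_chiPow_sub_one_le hh
  rw [← summable_nat_add_iff 1]
  refine Summable.of_nonneg_of_le (fun j => chiErr_nonneg n h _) (fun j => ?_)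
    ((summable_geometric_of_lt_one hρ.le hρ1).mul_left C)
  exact (bestL1_le _ (const_mem_trigPoly hn 1)).trans (hC j)

/-! ### The expansion in convolution powers -/

theorem powConv_succ {h : ℝ} (hh : 0 < h) {g : T → ℝ} (hg : MemLp g ⊤ volume) :
    ∀ j, powConv h (j + 1) g = powConv h j (circConv (chiPer h) g)
  | 0 => rfl
  | j + 1 => by
    change circConv (circConv (chiPer h) (chiPow h (j + 1))) g =
      circConv (chiPow h (j + 1)) (circConv (chiPer h) g)
    rw [circConv_comm (chiPer h), circConv_assoc (memLp_top_chiPow hh _) (memLp_top_chiPer hh) hg]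

theorem powConv_sub {h : ℝ} (hh : 0 < h) {v w : T → ℝ} (hv : MemLp v ⊤ volume)
    (hw : MemLp w ⊤ volume) (x : T) :
    ∀ j, powConv h j (fun y => v y - w y) x = powConv h j v x - powConv h j w x
  | 0 => rfl
  | _ + 1 => circConv_sub_right (integrable_chiPow hh _) hv hw x

theorem sub_sum_powConv {h : ℝ} (hh : 0 < h) {g : T → ℝ} (hg : MemLp g ⊤ volume) (N : ℕ) (x : T) :
    g x - ∑ j ∈ Finset.range N, powConv h j (fun y => g y - steklov h g y) x =
      powConv h N g x := by
  have hA := memLp_top_circConv (integrable_chiPer hh) hg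
  have h1 : ∀ j ∈ Finset.range N, powConv h j (fun y => g y - steklov h g y) x =
      powConv h j g x - powConv h (j + 1) g x := by
    intro j _
    rw [steklov_eq hh hg, powConv_sub hh hg hA, powConv_succ hh hg]
  rw [Finset.sum_congr rfl h1, Finset.sum_range_sub' (fun j => powConv h j g x)]
  change g x - (g x - _) = _
  ring

/-- The pairing with τ is the value at 0 of (φ ⊙ g) ⊙ σ, where σ(s) = τ(-s); by associativity it
contains the factor g ⊙ σ = 0. Hence g - g * χ_h is again orthogonal, and the error bounds apply to
it too. -/
theorem isPerp_circConv {n : ℕ} {φ g : T → ℝ} (hφ : MemLp φ ⊤ volume) (hg : IsPerp n g) :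
    IsPerp n (circConv φ g) := by
  refine ⟨memLp_top_circConv (hφ.integrable le_top) hg.1, fun τ hτ => ?_⟩
  set σ := τ.comp ⟨fun s : T => 0 - s, by fun_prop⟩ with hσ
  have hσ' : σ ∈ trigPoly n := comp_sub_left_mem_trigPoly hτ 0
  have h1 : ∫ x, circConv φ g x * τ x = circConv (circConv φ g) σ 0 := by
    refine integral_congr_ae (.of_forall fun t => ?_)
    simp [hσ]
  have h2 : circConv g σ = fun _ => 0 := by
    rw [circConv_comm]
    exact funext fun x => circConv_eq_zero_of_isPerp hg hσ' x
  rw [h1, circConv_assoc hφ hg.1 (memLp_top_continuousMap σ), h2]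
  simp [circConv]

theorem isPerp_sub {n : ℕ} {g g' : T → ℝ} (hg : IsPerp n g) (hg' : IsPerp n g') :
    IsPerp n fun x => g x - g' x := by
  refine ⟨hg.1.sub hg'.1, fun τ hτ => ?_⟩
  have hi : ∀ {u : T → ℝ}, MemLp u ⊤ volume → Integrable fun x => u x * τ x := fun hu =>
    (hu.integrable le_top).mul_of_top_left (memLp_top_continuousMap τ)
  simp only [sub_mul]
  rw [integral_sub (hi hg.1) (hi hg'.1), hg.2 τ hτ, hg'.2 τ hτ, sub_zero]

theorem essNorm_powConv_le {n : ℕ} {h : ℝ} (hh : 0 < h) {g : T → ℝ} (hg : IsPerp n g) :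
    ∀ j, essNorm (powConv h j g) ≤ chiErr n h j * essNorm g
  | 0 => by
    rw [chiErr, bestTV_dirac, one_mul]
    rfl
  | _ + 1 => essNorm_circConv_le (integrable_chiPow hh _) hg

theorem memLp_top_powConv {h : ℝ} (hh : 0 < h) {g : T → ℝ} (hg : MemLp g ⊤ volume) :
    ∀ j, MemLp (powConv h j g) ⊤ volume
  | 0 => hg
  | _ + 1 => memLp_top_circConv (integrable_chiPow hh _) hg

theorem essNorm_add_le {u v : T → ℝ} (hu : MemLp u ⊤ volume) (hv : MemLp v ⊤ volume) :
    essNorm (fun x => u x + v x) ≤ essNorm u + essNorm v := by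
  refine essNorm_le (add_nonneg (essNorm_nonneg _) (essNorm_nonneg _)) ?_
  filter_upwards [ae_abs_le_essNorm hu, ae_abs_le_essNorm hv] with x h1 h2
  exact (abs_add_le _ _).trans (add_le_add h1 h2)

theorem essNorm_sum_le {u : ℕ → T → ℝ} (hu : ∀ j, MemLp (u j) ⊤ volume) (N : ℕ) :
    essNorm (fun x => ∑ j ∈ Finset.range N, u j x) ≤ ∑ j ∈ Finset.range N, essNorm (u j) := by
  refine essNorm_le (Finset.sum_nonneg fun _ _ => essNorm_nonneg _) ?_
  filter_upwards [ae_all_iff.2 fun j => ae_abs_le_essNorm (hu j)] with x hx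
  exact (Finset.abs_sum_le_sum_abs _ _).trans (Finset.sum_le_sum fun j _ => hx j)

section Perp

variable {n : ℕ} {h : ℝ} {g : T → ℝ}

theorem isPerp_sub_steklov (hh : 0 < h) (hg : IsPerp n g) :
    IsPerp n fun x => g x - steklov h g x := by
  rw [steklov_eq hh hg.1]
  exact isPerp_sub hg (isPerp_circConv (memLp_top_chiPer hh) hg)

theorem tendsto_eLpNorm_sub_sum_powConv (hn : 1 ≤ n) (hh : 0 < h) (hg : IsPerp n g) :
    Tendsto (fun N : ℕ => eLpNorm (fun x => g x - ∑ j ∈ Finset.range N,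
      powConv h j (fun y => g y - steklov h g y) x) ⊤ volume) atTop (𝓝 0) := by
  simp_rw [sub_sum_powConv hh hg.1]
  have h1 : Tendsto (fun N => ENNReal.ofReal (chiErr n h N * essNorm g)) atTop (𝓝 0) := by
    have := ((summable_chiErr hn hh).tendsto_atTop_zero.mul_const (essNorm g))
    simpa using ENNReal.tendsto_ofReal this
  refine tendsto_of_tendsto_of_tendsto_of_le_of_le tendsto_const_nhds h1
    (fun _ => bot_le) fun N => ?_
  have := essNorm_powConv_le hh hg N
  rw [essNorm] at this
  exact (ENNReal.le_ofReal_iff_toReal_le (memLp_top_powConv hh hg.1 N).2.ne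
    (mul_nonneg (chiErr_nonneg _ _ _) (essNorm_nonneg _))).2 this

theorem essNorm_le_sum_add (hh : 0 < h) (hg : IsPerp n g) (N : ℕ) :
    essNorm g ≤ (∑ j ∈ Finset.range N,
      essNorm (powConv h j fun y => g y - steklov h g y)) + chiErr n h N * essNorm g := by
  have hu := (isPerp_sub_steklov hh hg).1
  have h1 : g = fun x => (∑ j ∈ Finset.range N, powConv h j (fun y => g y - steklov h g y) x) +
      powConv h N g x := by
    funext x
    rw [← sub_sum_powConv hh hg.1]
    ring
  have hs : MemLp (fun x => ∑ j ∈ Finset.range N,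
      powConv h j (fun y => g y - steklov h g y) x) ⊤ volume := by
    exact memLp_finsetSum _ fun j _ => memLp_top_powConv hh hu j
  calc essNorm g = essNorm fun x => (∑ j ∈ Finset.range N,
        powConv h j (fun y => g y - steklov h g y) x) + powConv h N g x := congrArg _ h1
    _ ≤ _ := essNorm_add_le hs (memLp_top_powConv hh hg.1 N)
    _ ≤ _ := add_le_add (essNorm_sum_le (fun j => memLp_top_powConv hh hu j) N)
        (essNorm_powConv_le hh hg N)

/-- Two terms of the expansion, both estimated trivially: convolution with a probability density
does not increase the norm. -/
theorem essNorm_le_two_mul (hh : 0 < h) (hg : IsPerp n g) :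
    essNorm g ≤ 2 * W2ess g h + chiErr n h 2 * essNorm g := by
  refine (essNorm_le_sum_add hh hg 2).trans (add_le_add ?_ le_rfl)
  have hu := (isPerp_sub_steklov hh hg).1
  rw [Finset.sum_range_succ, Finset.sum_range_one, two_mul]
  refine add_le_add le_rfl (essNorm_le (essNorm_nonneg _) (.of_forall fun x => ?_))
  refine (abs_circConv_le (integrable_chiPow hh 1) hu x).trans (le_of_eq ?_)
  simp_rw [abs_of_nonneg (chiPow_nonneg hh 1 _)]
  rw [integral_chiPow hh 0, one_mul]
  rfl

theorem essNorm_le_tsum_mul (hn : 1 ≤ n) (hh : 0 < h) (hg : IsPerp n g) :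
    essNorm g ≤ (1 + ∑' j : ℕ, chiErr n h (j + 1)) * W2ess g h := by
  have hs := summable_chiErr hn hh
  have h0 : 1 + ∑' j : ℕ, chiErr n h (j + 1) = ∑' j, chiErr n h j := by
    rw [hs.tsum_eq_zero_add, chiErr, bestTV_dirac]
  rw [h0]
  have hlim := (hs.hasSum.tendsto_sum_nat.mul_const (W2ess g h)).add
    (hs.tendsto_atTop_zero.mul_const (essNorm g))
  rw [zero_mul, add_zero] at hlim
  refine ge_of_tendsto' hlim fun N => ?_
  refine (essNorm_le_sum_add hh hg N).trans (add_le_add ?_ le_rfl)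
  rw [Finset.sum_mul]
  exact Finset.sum_le_sum fun j _ => essNorm_powConv_le hh (isPerp_sub_steklov hh hg) j

end Perp

theorem bestUnif_le_tsum_mul {n : ℕ} (hn : 1 ≤ n) {h : ℝ} (hh : 0 < h) (f : C(T, ℝ)) :
    bestUnif n f ≤ (∑' j : ℕ, chiErr n h j) * W2 f h := by
  have hs := summable_chiErr hn hh
  have hf := memLp_top_continuousMap f
  set u : C(T, ℝ) := f - circConvC (integrable_chiPer hh) f with hu
  have hu' : (fun y => f y - steklov h f y) = u := by
    rw [steklov_eq hh hf]
    rfl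
  have hW : W2 f h = ‖u‖ := by
    rw [ContinuousMap.norm_eq_iSup_norm, ← hu']
    rfl
  -- The range N + 1 separates the term of exponent 0, which is u itself and has coefficient `chiErr
  -- n h 0` = 1.
  have key : ∀ N, bestUnif n f ≤ (∑ j ∈ Finset.range (N + 1), chiErr n h j) * ‖u‖ +
      chiErr n h (N + 1) * ‖f‖ := by
    intro N
    have hdec : f = u + ∑ j ∈ Finset.range N, circConvC (integrable_chiPow hh (j + 1)) u +
        circConvC (integrable_chiPow hh (N + 1)) f := by
      ext x
      have h1 := sub_sum_powConv hh hf (N + 1) x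
      rw [hu', Finset.sum_range_succ'] at h1
      simp only [ContinuousMap.add_apply, ContinuousMap.sum_apply]
      change _ - (∑ j ∈ Finset.range N, circConvC (integrable_chiPow hh (j + 1)) u x + u x) =
        circConvC (integrable_chiPow hh (N + 1)) f x at h1
      linarith
    have hsum : ∀ N, bestUnif n (∑ j ∈ Finset.range N, circConvC (integrable_chiPow hh (j + 1)) u)
        ≤ ∑ j ∈ Finset.range N, chiErr n h (j + 1) * ‖u‖ := by
      intro N
      induction N with
      | zero => simpa using bestUnif_le_norm n 0
      | succ N ih =>
        rw [Finset.sum_range_succ, Finset.sum_range_succ]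
        exact (bestUnif_add_le _ _ _).trans (add_le_add ih (bestUnif_circConvC_le _ _))
    calc bestUnif n f = bestUnif n (u +
          ∑ j ∈ Finset.range N, circConvC (integrable_chiPow hh (j + 1)) u +
          circConvC (integrable_chiPow hh (N + 1)) f) := congrArg _ hdec
      _ ≤ ‖u‖ + ∑ j ∈ Finset.range N, chiErr n h (j + 1) * ‖u‖ + chiErr n h (N + 1) * ‖f‖ :=
        (bestUnif_add_le _ _ _).trans (add_le_add ((bestUnif_add_le _ _ _).trans
          (add_le_add (bestUnif_le_norm _ _) (hsum N))) (bestUnif_circConvC_le _ _))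
      _ = _ := by
        have : chiErr n h 0 = 1 := bestTV_dirac n
        rw [Finset.sum_range_succ', add_mul, this, one_mul, Finset.sum_mul, add_comm ‖u‖]
  rw [hW]
  have hlim := ((hs.hasSum.tendsto_sum_nat.mul_const ‖u‖).add
    (hs.tendsto_atTop_zero.mul_const ‖f‖)).comp (tendsto_add_atTop_nat 1)
  rw [zero_mul, add_zero] at hlim
  exact ge_of_tendsto' hlim key

/-! ### The Favard-type constants -/

/-- The partial fraction expansion of the cotangent. Its `cotTerm` pairs the indices ±(N + 1), which
is exactly one step of the symmetric partial sums. -/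
theorem hasSum_symmetricIcc_one_div_add {x : ℝ} (hx : ∀ k : ℤ, x ≠ k) :
    HasSum (fun k : ℤ => 1 / (k + x)) (Real.pi * Real.cot (Real.pi * x)) (symmetricIcc ℤ) := by
  rw [SummationFilter.hasSum_symmetricIcc_iff]
  have hxc : (x : ℂ) ∈ Complex.integerComplement := by
    rintro ⟨k, hk⟩
    exact hx k (by exact_mod_cast hk.symm)
  have h1 := (tendsto_logDeriv_euler_cot_sub hxc).add_const (1 / (x : ℂ))
  rw [sub_add_cancel] at h1
  have h2 : ∀ N : ℕ, ∑ j ∈ Finset.range N, cotTerm (x : ℂ) j + 1 / (x : ℂ) =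
      ((∑ k ∈ Finset.Icc (-(N : ℤ)) N, 1 / ((k : ℝ) + x) : ℝ) : ℂ) := by
    intro N
    induction N with
    | zero => simp
    | succ N ih =>
      rw [Finset.sum_range_succ, add_right_comm, ih, Nat.cast_add, Nat.cast_one,
        Finset.Icc_succ_succ, Finset.sum_union (by simp), Finset.sum_pair (by lia), cotTerm]
      push_cast
      have e1 : (-((N : ℂ) + 1) + x) = x - (N + 1) := by ring
      have e2 : ((N : ℂ) + 1 + x) = x + (N + 1) := by ring
      rw [e1, e2]
  simp_rw [h2] at h1
  rw [← Complex.ofReal_mul, ← Complex.ofReal_cot, ← Complex.ofReal_mul] at h1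
  exact tendsto_ofReal_iff.1 h1

/-- The numbers `2 / (π (4k + 1))`, whose power sums are the constants `F`. -/
def favNode (k : ℤ) : ℝ := 2 / (Real.pi * (4 * k + 1))

theorem four_mul_add_one_ne_zero (k : ℤ) : (4 * (k : ℝ) + 1) ≠ 0 := by
  have : 4 * k + 1 ≠ 0 := by lia
  exact_mod_cast this

theorem F_eq (j : ℕ) : F j = 2 * ∑'[symmetricIcc ℤ] k : ℤ, favNode k ^ (j + 1) := by
  rw [F, mul_assoc, ← tsum_mul_left]
  congr 1
  refine tsum_congr fun k => ?_
  rw [favNode, ← div_div, div_pow _ (_ + _), mul_one_div]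

theorem abs_favNode_le (k : ℤ) : |favNode k| ≤ 2 / Real.pi := by
  rw [favNode, abs_div, abs_mul, abs_of_pos Real.pi_pos, abs_two]
  have h1 : (1 : ℝ) ≤ |4 * (k : ℝ) + 1| := by
    have : (1 : ℤ) ≤ |4 * k + 1| := Int.one_le_abs (by lia)
    exact_mod_cast this
  gcongr
  exact le_mul_of_one_le_right Real.pi_pos.le h1

theorem two_div_pi_lt_one : 2 / Real.pi < 1 := by
  rw [div_lt_one Real.pi_pos]
  linarith [Real.pi_gt_three]

theorem summable_favNode_sq : Summable fun k => favNode k ^ 2 := by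
  have := ((Real.summable_one_div_int_add_rpow (1 / 4) 2).2 (by norm_num)).mul_left
    (1 / (2 * Real.pi)) |>.mul_left (1 / (2 * Real.pi))
  refine this.congr fun k => ?_
  have := four_mul_add_one_ne_zero k
  have h2 : (k : ℝ) + 1 / 4 ≠ 0 := fun h => this (by linarith)
  rw [Real.rpow_two, sq_abs, favNode]
  field_simp
  ring

theorem summable_favNode_pow (j : ℕ) : Summable fun k => favNode k ^ (j + 2) := by
  refine Summable.of_norm_bounded summable_favNode_sq fun k => ?_
  rw [Real.norm_eq_abs, pow_add, abs_mul, abs_pow, abs_of_nonneg (sq_nonneg (favNode k))]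
  exact mul_le_of_le_one_left (sq_nonneg _) (pow_le_one₀ (abs_nonneg _)
    ((abs_favNode_le k).trans two_div_pi_lt_one.le))

theorem F_succ_eq (j : ℕ) : F (j + 1) = 2 * ∑' k : ℤ, favNode k ^ (j + 2) := by
  rw [F_eq, tsum_eq_of_summable_unconditional (summable_favNode_pow j)]

theorem hasSum_symmetricIcc_favNode : HasSum favNode (1 / 2) (symmetricIcc ℤ) := by
  have h := (hasSum_symmetricIcc_one_div_add (x := 1 / 4) (fun k hk => by
    have : 1 = 4 * k := by exact_mod_cast (by linarith : (1 : ℝ) = 4 * k)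
    lia)).mul_left (1 / (2 * Real.pi))
  have h4 : Real.cot (Real.pi * (1 / 4)) = 1 := by
    rw [mul_one_div, ← Real.tan_inv_eq_cot, Real.tan_pi_div_four, inv_one]
  rw [h4] at h
  have hpi := Real.pi_ne_zero
  have h5 : 1 / (2 * Real.pi) * (Real.pi * 1) = 1 / 2 := by field_simp
  rw [h5] at h
  refine h.congr_fun fun k => ?_
  have h1 := four_mul_add_one_ne_zero k
  have h2 : (k : ℝ) + 1 / 4 ≠ 0 := fun h => h1 (by linarith)
  rw [favNode]
  field_simp
  ring

theorem F_zero : F 0 = 1 := by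
  rw [F_eq]
  simp only [zero_add, pow_one]
  rw [hasSum_symmetricIcc_favNode.tsum_eq]
  norm_num

/-- With a = `favNode k`, a/(1 - a) = (1/2π)/(k + x) for x = 1/4 - 1/(2π), so the cotangent
expansion at x applies. -/
theorem hasSum_favNode_div :
    HasSum (fun k => favNode k / (1 - favNode k))
      ((1 / Real.cos 1 + Real.tan 1) / 2) (symmetricIcc ℤ) := by
  have hpi := Real.pi_pos
  have hne : ∀ k : ℤ, Real.pi * (4 * k + 1) - 2 ≠ 0 := by
    intro k hk
    have h1 : Real.pi * (4 * k + 1) = 2 := by linarith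
    have h2 : 0 < (4 * (k : ℝ) + 1) := pos_of_mul_pos_right (h1 ▸ two_pos) hpi.le
    have h3 : (1 : ℝ) ≤ 4 * (k : ℝ) + 1 := by
      have : 0 < 4 * k + 1 := by exact_mod_cast h2
      exact_mod_cast this
    nlinarith [Real.pi_gt_three]
  have h := (hasSum_symmetricIcc_one_div_add (x := 1 / 4 - 1 / (2 * Real.pi)) (fun k hk => by
    apply hne (-k)
    field_simp at hk
    push_cast
    linarith)).mul_left (1 / (2 * Real.pi))
  have hval : 1 / (2 * Real.pi) *
      (Real.pi * Real.cot (Real.pi * (1 / 4 - 1 / (2 * Real.pi)))) =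
      (1 / Real.cos 1 + Real.tan 1) / 2 := by
    have h5 : Real.pi * (1 / 4 - 1 / (2 * Real.pi)) = (Real.pi / 2 - 1) / 2 := by
      field_simp
      ring
    rw [h5, Real.cot_eq_cos_div_sin]
    -- Since 2u = π/2 - 1, cot u = (1 + cos 2u)/sin 2u = (1 + sin 1)/cos 1.
    set u := (Real.pi / 2 - 1) / 2 with hu
    have hc : Real.cos 1 = 2 * Real.sin u * Real.cos u := by
      rw [← Real.sin_two_mul, hu, mul_div_cancel₀ _ two_ne_zero, Real.sin_pi_div_two_sub]
    have hs : Real.sin 1 = 2 * Real.cos u ^ 2 - 1 := by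
      rw [← Real.cos_two_mul, hu, mul_div_cancel₀ _ two_ne_zero, Real.cos_pi_div_two_sub]
    have hc0 := Real.cos_one_pos.ne'
    rw [Real.tan_eq_sin_div_cos, hs, hc]
    rw [hc] at hc0
    have hs0 : Real.sin u ≠ 0 := by
      rintro h0
      simp [h0] at hc0
    have hc1 : Real.cos u ≠ 0 := by
      rintro h0
      simp [h0] at hc0
    field_simp
    ring
  rw [hval] at h
  refine h.congr_fun fun k => ?_
  have h1 := four_mul_add_one_ne_zero k
  have h2 := hne k
  have h3 : (k : ℝ) + (1 / 4 - 1 / (2 * Real.pi)) =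
      (Real.pi * (4 * k + 1) - 2) / (4 * Real.pi) := by
    field_simp
    ring
  have h4 : 1 - favNode k = (Real.pi * (4 * k + 1) - 2) / (Real.pi * (4 * k + 1)) := by
    rw [favNode]
    field_simp
  rw [h3, h4, favNode, div_div_div_cancel_right₀ (mul_ne_zero hpi.ne' h1), one_div_div]
  field_simp
  norm_num

/-- Summing geometric series over j. The exchange of sums needs absolute convergence, which fails
for exponent 1; so that exponent is kept apart through a/(1 - a) = a + a²/(1 - a), and only the
exponents from 2 on are exchanged. -/
theorem hasSum_F : HasSum F (1 / Real.cos 1 + Real.tan 1) := by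
  have hr0 : (0 : ℝ) ≤ 2 / Real.pi := by positivity
  have hs : Summable fun p : ℕ × ℤ => favNode p.2 ^ (p.1 + 2) := by
    have hg := (summable_geometric_of_lt_one hr0 two_div_pi_lt_one).mul_of_nonneg
      summable_favNode_sq (fun j => by positivity) fun k => sq_nonneg _
    refine Summable.of_norm_bounded hg fun p => ?_
    rw [Real.norm_eq_abs, pow_add, abs_mul, abs_pow, abs_of_nonneg (sq_nonneg (favNode p.2))]
    have := abs_favNode_le p.2
    gcongr
  obtain ⟨S, hS⟩ := hs
  have h1 : HasSum (fun j : ℕ => ∑' k : ℤ, favNode k ^ (j + 2)) S :=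
    hS.prod_fiberwise fun j => (summable_favNode_pow j).hasSum
  have habs : ∀ k, |favNode k| < 1 := fun k => (abs_favNode_le k).trans_lt two_div_pi_lt_one
  have hS' : HasSum (fun p : ℤ × ℕ => favNode p.1 ^ (p.2 + 2)) S :=
    (Equiv.prodComm ℤ ℕ).hasSum_iff.2 hS
  have h2 : HasSum (fun k : ℤ => favNode k ^ 2 * (1 - favNode k)⁻¹) S := by
    refine hS'.prod_fiberwise fun k => ?_
    refine ((hasSum_geometric_of_abs_lt_one (habs k)).mul_left (favNode k ^ 2)).congr_fun
      fun j => ?_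
    change favNode k ^ (j + 2) = _
    ring
  have h3 : HasSum (fun k : ℤ => favNode k ^ 2 * (1 - favNode k)⁻¹) S (symmetricIcc ℤ) :=
    h2.mono_left (symmetricIcc ℤ).le_atTop
  have h4 := hasSum_symmetricIcc_favNode.add h3
  have h5 : 1 / 2 + S = (1 / Real.cos 1 + Real.tan 1) / 2 := by
    refine h4.unique ?_
    refine hasSum_favNode_div.congr_fun fun k => ?_
    have : 1 - favNode k ≠ 0 := by linarith [(abs_lt.1 (habs k)).2]
    field_simp
    ring
  have h6 : 1 / Real.cos 1 + Real.tan 1 = F 0 + 2 * S := by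
    rw [F_zero]
    linarith
  rw [h6]
  refine HasSum.zero_add ?_
  simp_rw [F_succ_eq]
  exact h1.mul_left 2

/-- The odd integers are enumerated as -2l - 1 because i ↦ -i - 1 changes the sign of 2i + 1: as
sinc is even, both halves then become the same series in `favNode`, which explains the factor 2 in
F. -/
theorem hasSum_int_of_even_of_neg {f : ℤ → ℝ} {a b : ℝ} (ha : HasSum (fun l : ℤ => f (2 * l)) a)
    (hb : HasSum (fun l : ℤ => f (-(2 * l) - 1)) b) : HasSum f (a + b) := by
  have he : Function.Injective fun l : ℤ => 2 * l := fun l m h => by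
    simp only at h
    lia
  have ho : Function.Injective fun l : ℤ => -(2 * l) - 1 := fun l m h => by
    simp only at h
    lia
  refine HasSum.add_isCompl (s := Set.range fun l : ℤ => 2 * l)
    (t := Set.range fun l : ℤ => -(2 * l) - 1) ?_ (he.hasSum_range_iff.2 ha)
    (ho.hasSum_range_iff.2 hb)
  constructor
  · rw [Set.disjoint_left]
    rintro _ ⟨l, rfl⟩ ⟨m, hm⟩
    simp only at hm
    lia
  · rw [codisjoint_iff_le_sup]
    intro i _
    rcases Int.even_or_odd' i with ⟨l, h | h⟩
    · exact Or.inl ⟨l, h.symm⟩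
    · exact Or.inr ⟨-l - 1, by simp only; lia⟩

theorem sinc_half_odd_eq_favNode (l : ℤ) :
    sinc (Real.pi * (2 * (2 * l : ℤ) + 1) / 2) = favNode l := by
  have hpi := Real.pi_ne_zero
  have h1 := four_mul_add_one_ne_zero l
  have h2 : Real.pi * (2 * (2 * l : ℤ) + 1) / 2 = Real.pi / 2 + l * (2 * Real.pi) := by
    push_cast
    ring
  have h3 : Real.pi * (2 * (2 * l : ℤ) + 1) / 2 = Real.pi * (4 * l + 1) / 2 := by
    push_cast
    ring
  rw [Real.sinc_of_ne_zero (by rw [h3]; positivity), h2, Real.sin_add_int_mul_two_pi,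
    Real.sin_pi_div_two, ← h2, h3, favNode, one_div, inv_div]

theorem hasSum_sinc_half_odd_pow (j : ℕ) :
    HasSum (fun i : ℤ => sinc (Real.pi * (2 * i + 1) / 2) ^ (j + 2)) (F (j + 1)) := by
  rw [F_succ_eq, two_mul]
  refine hasSum_int_of_even_of_neg ?_ ?_
  · refine (summable_favNode_pow j).hasSum.congr_fun fun l => ?_
    rw [sinc_half_odd_eq_favNode]
  · refine (summable_favNode_pow j).hasSum.congr_fun fun l => ?_
    rw [← sinc_half_odd_eq_favNode, ← Real.sinc_neg]
    push_cast
    congr 2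
    ring

/-- The absolute values |4k + 1| run once through the odd positive integers, and the sign of 4k + 1
is the character mod 4. The sum is thus the L-value π³/32 at 3. -/
theorem F_two : F 2 = 1 / 2 := by
  have hinj : Function.Injective fun k : ℤ => (4 * k + 1).natAbs := fun k l h => by
    simp only at h
    lia
  have h := hasSum_L_function_mod_four_eval_three
  rw [← hinj.hasSum_iff] at h
  · have h1 : HasSum (fun k : ℤ => favNode k ^ 3) ((2 / Real.pi) ^ 3 * (Real.pi ^ 3 / 32)) := by
      refine (h.mul_left _).congr_fun fun k => ?_
      have h2 : (((4 * k + 1).natAbs : ℕ) : ℝ) = |4 * (k : ℝ) + 1| := by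
        rw [Nat.cast_natAbs]
        push_cast
        rfl
      have h3 : Real.sin (Real.pi * (4 * k + 1) / 2) = 1 := by
        rw [show Real.pi * (4 * k + 1) / 2 = Real.pi / 2 + k * (2 * Real.pi) by ring,
          Real.sin_add_int_mul_two_pi, Real.sin_pi_div_two]
      rw [Function.comp_apply, h2, favNode]
      rcases abs_cases (4 * (k : ℝ) + 1) with ⟨h4, _⟩ | ⟨h4, _⟩
      · rw [h4, h3, mul_one, ← div_div, div_pow, mul_one_div]
      · rw [h4, mul_neg, neg_div, Real.sin_neg, h3, ← div_div, div_pow,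
          Odd.neg_pow (by decide), div_neg]
        ring
    rw [F_succ_eq, h1.tsum_eq]
    have := Real.pi_ne_zero
    field_simp
    norm_num
  · intro m hm
    have hev : Even m := by
      by_contra hodd
      rw [Nat.not_even_iff_odd] at hodd
      apply hm
      obtain ⟨r, hr⟩ := hodd
      rcases Nat.even_or_odd' r with ⟨s, hs | hs⟩
      · exact ⟨s, by simp only; lia⟩
      · exact ⟨-s - 1, by simp only; lia⟩
    obtain ⟨r, rfl⟩ := hev
    have : Real.pi * ((r + r : ℕ) : ℝ) / 2 = r * Real.pi := by
      push_cast
      ring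
    rw [this, Real.sin_nat_mul_pi, mul_zero]

/-- The Taylor polynomial of exp at i with ten terms bounds cos 1 and sin 1 simultaneously; after
multiplication by cos 1 > 0 the claim is linear in the two. -/
theorem sec_add_tan_one_bounds :
    3.408 < 1 / Real.cos 1 + Real.tan 1 ∧ 1 / Real.cos 1 + Real.tan 1 < 3.409 := by
  have h := Complex.exp_bound (x := Complex.I) (by simp) (n := 10) (by norm_num)
  have hsum : ∑ m ∈ Finset.range 10, Complex.I ^ m / (m.factorial : ℂ) =
      ((1 - 1 / 2 + 1 / 24 - 1 / 720 + 1 / 40320 : ℝ) : ℂ) +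
        ((1 - 1 / 6 + 1 / 120 - 1 / 5040 + 1 / 362880 : ℝ) : ℂ) * Complex.I := by
    have e : ∀ m, Complex.I ^ (m + 2) = - Complex.I ^ m := fun m => by
      rw [pow_add, Complex.I_sq]
      ring
    simp only [Finset.sum_range_succ, Finset.sum_range_zero, e, pow_zero, pow_one,
      Nat.factorial]
    push_cast
    ring
  have hexp : Complex.exp Complex.I = (Real.cos 1 : ℂ) + (Real.sin 1 : ℂ) * Complex.I := by
    have := Complex.exp_mul_I (1 : ℝ)
    rw [Complex.ofReal_one, one_mul] at this
    rw [this]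
    push_cast
    rfl
  rw [hsum, hexp] at h
  have hre := (Complex.abs_re_le_norm _).trans h
  have him := (Complex.abs_im_le_norm _).trans h
  simp only [Complex.sub_re, Complex.sub_im, Complex.add_re, Complex.add_im, Complex.ofReal_re,
    Complex.ofReal_im, Complex.mul_re, Complex.mul_im, Complex.I_re, Complex.I_im,
    Complex.norm_I, Nat.factorial] at hre him
  norm_num at hre him
  rw [abs_le] at hre him
  have hc := Real.cos_one_pos
  rw [Real.tan_eq_sin_div_cos, ← add_div, lt_div_iff₀ hc, div_lt_iff₀ hc]
  constructor <;> linarith [hre.1, hre.2, him.1, him.2]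

/-! ### The square wave -/

/-- The square wave `sign (cos (2πnx))`. -/
def sqWave (n : ℕ) (x : T) : ℝ := if 0 ≤ cosT n x then 1 else -1

theorem abs_sqWave (n : ℕ) (x : T) : |sqWave n x| = 1 := by
  rw [sqWave]
  split_ifs <;> simp

theorem sqWave_mul_cosT (n : ℕ) (x : T) : sqWave n x * cosT n x = |cosT n x| := by
  rw [sqWave]
  split_ifs with h
  · rw [one_mul, abs_of_nonneg h]
  · rw [abs_of_neg (not_le.1 h), neg_one_mul]

theorem measurable_sqWave (n : ℕ) : Measurable (sqWave n) :=
  Measurable.ite (measurableSet_le measurable_const (cosT n).continuous.measurable)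
    measurable_const measurable_const

theorem memLp_top_sqWave (n : ℕ) : MemLp (sqWave n) ⊤ volume :=
  memLp_top_of_bound (measurable_sqWave n).aestronglyMeasurable 1
    (.of_forall fun x => (abs_sqWave n x).le)

theorem sqWave_coe_eq {n : ℕ} (hn : 1 ≤ n) {r : ℕ} {x : ℝ}
    (hx : x ∈ Set.Ioo (-(1 / (2 * n) : ℝ) / 2 + r * (1 / (2 * n)))
      ((1 / (2 * n) : ℝ) / 2 + r * (1 / (2 * n)))) : sqWave n (x : T) = (-1) ^ r := by
  have hn0 : (0 : ℝ) < n := by exact_mod_cast hn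
  have hpi := Real.pi_pos
  have h1 : cosT n (x : T) = (-1) ^ r * Real.cos (2 * Real.pi * n * (x - r * (1 / (2 * n)))) := by
    rw [cosT_coe, ← Real.cos_add_nat_mul_pi]
    congr 1
    push_cast
    field_simp
    ring
  have h2 : 0 < Real.cos (2 * Real.pi * n * (x - r * (1 / (2 * n)))) := by
    have e : 2 * Real.pi * n * ((1 / (2 * n) : ℝ) / 2) = Real.pi / 2 := by
      field_simp
    have hp : 0 < 2 * Real.pi * n := by positivity
    refine Real.cos_pos_of_mem_Ioo ⟨?_, ?_⟩
    · rw [← e, ← mul_neg]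
      exact mul_lt_mul_of_pos_left (by linarith [hx.1]) hp
    · rw [← e]
      exact mul_lt_mul_of_pos_left (by linarith [hx.2]) hp
  rw [sqWave, h1]
  rcases neg_one_pow_eq_or ℝ r with h3 | h3
  · rw [h3, if_pos (by linarith)]
  · rw [h3, if_neg (by linarith)]

theorem fourier_add_coe (k : ℤ) (x y : ℝ) :
    (fourier k ((x + y : ℝ) : T) : ℂ) = fourier k (x : T) * fourier k (y : T) := by
  rw [fourier_coe_eq_exp, fourier_coe_eq_exp, fourier_coe_eq_exp, ← Complex.exp_add]
  push_cast
  congr 1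
  ring

/-- The period, started at -h/2 with h = 1/(2n), splits into 2n intervals on whose interiors the
wave is ±1. They are translates of the first one with alternating signs, whence a geometric sum. -/
theorem fourierCoeff_sqWave_eq_sum {n : ℕ} (hn : 1 ≤ n) (k : ℤ) :
    fourierCoeff (fun x => (sqWave n x : ℂ)) k =
      ((1 / (2 * n) * sinc (Real.pi * k / (2 * n)) : ℝ) : ℂ) *
        ∑ r ∈ Finset.range (2 * n), (-fourier (-k) ((1 / (2 * n) : ℝ) : T) : ℂ) ^ r := by
  have hn0 : (0 : ℝ) < n := by exact_mod_cast hn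
  set h : ℝ := 1 / (2 * n) with hh
  have hpos : 0 < h := by positivity
  set a : ℕ → ℝ := fun r => -h / 2 + r * h with ha
  have ha' : ∀ r : ℕ, a (r + 1) = h / 2 + r * h := fun r => by
    simp only [ha]
    push_cast
    ring
  have hend : a 0 + 1 = a (2 * n) := by
    simp only [ha, hh]
    push_cast
    field_simp
    ring
  set G : ℝ → ℂ := fun x => fourier (-k) (x : T) • ((sqWave n (x : T) : ℝ) : ℂ) with hG
  have hGint : ∀ b c : ℝ, IntervalIntegrable G volume b c := by
    intro b c
    refine (intervalIntegrable_const (c := (1 : ℝ))).mono_fun ?_ (.of_forall fun x => ?_)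
    · refine Measurable.aestronglyMeasurable ?_
      refine Measurable.mul ?_ (Complex.measurable_ofReal.comp
        ((measurable_sqWave n).comp AddCircle.measurable_mk'))
      exact ((map_continuous (fourier (-k))).comp (AddCircle.continuous_mk' 1)).measurable
    · simp only [hG, smul_eq_mul, norm_mul, fourier_apply, Circle.norm_coe, Complex.norm_real,
        Real.norm_eq_abs, abs_sqWave, mul_one, abs_one, le_refl]
  rw [fourierCoeff_eq_intervalIntegral _ _ (a 0), hend, div_one, one_smul,
    ← intervalIntegral.sum_integral_adjacent_intervals fun r _ => hGint _ _, Finset.mul_sum]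
  refine Finset.sum_congr rfl fun r _ => ?_
  have e1 : ∫ x in a r..a (r + 1), G x =
      ∫ x in a r..a (r + 1), (fourier (-k) (x : T) : ℂ) * (-1) ^ r := by
    have hle : a r ≤ a (r + 1) := by
      rw [ha']
      simp only [ha]
      linarith
    rw [intervalIntegral.integral_of_le hle, intervalIntegral.integral_of_le hle,
      integral_Ioc_eq_integral_Ioo, integral_Ioc_eq_integral_Ioo]
    refine setIntegral_congr_fun measurableSet_Ioo fun x hx => ?_
    rw [ha'] at hx
    simp only [hG, smul_eq_mul]
    rw [sqWave_coe_eq hn hx]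
    push_cast
    rfl
  have e2 : ∫ x in a r..a (r + 1), (fourier (-k) (x : T) : ℂ) =
      (h * sinc (Real.pi * k * h) : ℝ) * (fourier (-k) (h : T) : ℂ) ^ r := by
    rw [← intervalIntegral_fourier_neg, ← intervalIntegral.integral_mul_const, ha']
    simp only [ha]
    rw [← intervalIntegral.integral_comp_add_right (fun x : ℝ => (fourier (-k) (x : T) : ℂ))]
    refine intervalIntegral.integral_congr fun x _ => ?_
    rw [fourier_add_coe]
    congr 1
    rw [fourier_coe_eq_exp, fourier_coe_eq_exp, ← Complex.exp_nat_mul]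
    push_cast
    congr 1
    ring
  rw [e1, intervalIntegral.integral_mul_const, e2, neg_pow, hh, mul_one_div]
  push_cast
  ring

/-- The ratio of the geometric sum is a 2n-th root of unity, equal to 1 only when k is an odd
multiple of n. -/
theorem fourierCoeff_sqWave_of_ne {n : ℕ} (hn : 1 ≤ n) {k : ℤ}
    (hk : ∀ i : ℤ, k ≠ n * (2 * i + 1)) : fourierCoeff (fun x => (sqWave n x : ℂ)) k = 0 := by
  have hn0 : (0 : ℝ) < n := by exact_mod_cast hn
  have hnC : (n : ℂ) ≠ 0 := by exact_mod_cast hn0.ne'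
  have hpi : (Real.pi : ℂ) ≠ 0 := by exact_mod_cast Real.pi_ne_zero
  rw [fourierCoeff_sqWave_eq_sum hn]
  set ω : ℂ := fourier (-k) ((1 / (2 * n) : ℝ) : T) with hω
  have hω2 : (-ω) ^ (2 * n) = 1 := by
    rw [Even.neg_pow (even_two_mul n), hω, fourier_coe_eq_exp, ← Complex.exp_nat_mul]
    rw [Complex.exp_eq_one_iff]
    refine ⟨-k, ?_⟩
    push_cast
    field_simp
  have hω1 : -ω ≠ 1 := by
    intro h
    have h1 : ω = Complex.exp (Real.pi * Complex.I) := by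
      rw [Complex.exp_pi_mul_I]
      linear_combination -h
    rw [hω, fourier_coe_eq_exp, Complex.exp_eq_exp_iff_exists_int] at h1
    obtain ⟨m, hm⟩ := h1
    apply hk (-m - 1)
    have hI := Complex.I_ne_zero
    push_cast at hm
    field_simp at hm
    have : ((k : ℤ) : ℂ) = ((n * (2 * (-m - 1) + 1) : ℤ) : ℂ) := by
      push_cast
      linear_combination -hm
    exact_mod_cast this
  rw [geom_sum_eq hω1, hω2]
  simp

theorem fourierCoeff_sqWave_odd {n : ℕ} (hn : 1 ≤ n) (i : ℤ) :
    fourierCoeff (fun x => (sqWave n x : ℂ)) (n * (2 * i + 1)) =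
      (sinc (Real.pi * (2 * i + 1) / 2) : ℝ) := by
  have hn0 : (0 : ℝ) < n := by exact_mod_cast hn
  have hnC : (n : ℂ) ≠ 0 := by exact_mod_cast hn0.ne'
  rw [fourierCoeff_sqWave_eq_sum hn]
  have hω : (fourier (-(n * (2 * i + 1))) ((1 / (2 * n) : ℝ) : T) : ℂ) = -1 := by
    rw [fourier_coe_eq_exp, ← Complex.exp_pi_mul_I, Complex.exp_eq_exp_iff_exists_int]
    refine ⟨-i - 1, ?_⟩
    push_cast
    field_simp
    ring
  rw [hω]
  have e : Real.pi * ((n * (2 * i + 1) : ℤ) : ℝ) / (2 * n) = Real.pi * (2 * i + 1) / 2 := by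
    push_cast
    field_simp
  rw [e]
  simp
  field_simp

theorem integral_sqWave_mul_eq_zero {n : ℕ} (hn : 1 ≤ n) {τ : C(T, ℝ)} (hτ : τ ∈ trigPoly n) :
    ∫ x, sqWave n x * τ x = 0 := by
  obtain ⟨a, b, h⟩ := mem_trigPoly_iff.1 hτ
  have hint : ∀ f : C(T, ℝ), Integrable fun t => sqWave n t * f t := fun f =>
    ((memLp_top_sqWave n).integrable le_top).mul_of_top_left (memLp_top_continuousMap f)
  have hz : ∀ j : ℕ, j < n → (∫ t, sqWave n t * cosT j t) = 0 ∧
      (∫ t, sqWave n t * sinT j t) = 0 := by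
    intro j hj
    -- An index of absolute value less than n is no odd multiple of n. The frequency -j is used so
    -- that the integrand contains `fourier j`, with real part `cosT j` and imaginary part `sinT j`.
    have h0 : fourierCoeff (fun x => (sqWave n x : ℂ)) (-(j : ℤ)) = 0 := by
      refine fourierCoeff_sqWave_of_ne hn fun i hi => ?_
      have h1 : (n : ℤ) * (2 * i + 1) ≤ 0 := by lia
      have h2 : -(n : ℤ) < n * (2 * i + 1) := by lia
      have hn' : (0 : ℤ) < n := by lia
      have h3 : 2 * i + 1 ≤ 0 := nonpos_of_mul_nonpos_right h1 hn'
      have h4 : (n : ℤ) * (-1) < n * (2 * i + 1) := by linarith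
      have h5 := lt_of_mul_lt_mul_left h4 hn'.le
      lia
    rw [fourierCoeff_eq_integral, neg_neg] at h0
    have hI : Integrable fun t : T => (fourier j t : ℂ) * (sqWave n t : ℂ) :=
      ((memLp_top_fourier j).integrable le_top).mul_of_top_left
        (MemLp.ofReal (K := ℂ) (memLp_top_sqWave n))
    constructor
    · have h1 := integral_re hI
      rw [h0] at h1
      simp only [RCLike.re_eq_complex_re, Complex.re_mul_ofReal, Complex.zero_re] at h1
      rw [← h1]
      simp only [mul_comm]
      rfl
    · have h1 := integral_im hI
      rw [h0] at h1
      simp only [RCLike.im_eq_complex_im, Complex.im_mul_ofReal, Complex.zero_im] at h1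
      rw [← h1]
      simp only [mul_comm]
      rfl
  have : ∀ t, sqWave n t * τ t = ∑ j ∈ Finset.range n,
      (a j * (sqWave n t * cosT j t) + b j * (sqWave n t * sinT j t)) := by
    intro t
    rw [h, Finset.mul_sum]
    exact Finset.sum_congr rfl fun j _ => by ring
  simp_rw [this]
  rw [integral_finsetSum _ fun (j : ℕ) _ => by
    exact ((hint (cosT j)).const_mul _).add ((hint (sinT j)).const_mul _)]
  refine Finset.sum_eq_zero fun j hj => ?_
  rw [integral_add ((hint _).const_mul _) ((hint _).const_mul _), integral_const_mul,
    integral_const_mul, (hz j (Finset.mem_range.1 hj)).1, (hz j (Finset.mem_range.1 hj)).2]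
  simp

/-- Parseval leaves only the frequencies n(2i + 1). For h = 1/(2n) the wave and the kernel have
there the same coefficient sinc(π(2i + 1)/2), so its power j + 2 is summed. -/
theorem integral_sqWave_mul_chiPow {n : ℕ} (hn : 1 ≤ n) (j : ℕ) :
    ∫ x, sqWave n x * chiPow (1 / (2 * n)) (j + 1) x = F (j + 1) := by
  have hn0 : (0 : ℝ) < n := by exact_mod_cast hn
  have hpos : (0 : ℝ) < 1 / (2 * n) := by positivity
  have h1 := hasSum_conj_fourierCoeff_mul
    ((MemLp.ofReal (K := ℂ) (memLp_top_sqWave n)).mono_exponent (p := 2) le_top)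
    ((MemLp.ofReal (K := ℂ) (memLp_top_chiPow hpos (j + 1))).mono_exponent (p := 2) le_top)
  simp only [RCLike.ofReal_eq_complex_ofReal, Complex.conj_ofReal, ← Complex.ofReal_mul,
      integral_complex_ofReal, fourierCoeff_chiPow hpos] at h1
  have hinj : Function.Injective fun i : ℤ => (n : ℤ) * (2 * i + 1) := by
    intro i i' h
    have := mul_left_cancel₀ (by lia : (n : ℤ) ≠ 0) h
    lia
  rw [← hinj.hasSum_iff] at h1
  · have h2 := (Complex.hasSum_ofReal.2 (hasSum_sinc_half_odd_pow j))
    refine Complex.ofReal_injective (h1.unique (h2.congr_fun fun i => ?_))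
    simp only [Function.comp_apply]
    rw [fourierCoeff_sqWave_odd hn, Complex.conj_ofReal, ← Complex.ofReal_mul]
    congr 1
    have e : Real.pi * ((n * (2 * i + 1) : ℤ) : ℝ) * (1 / (2 * n)) =
        Real.pi * (2 * i + 1) / 2 := by
      push_cast
      field_simp
    rw [e]
    ring
  · intro k hk
    rw [fourierCoeff_sqWave_of_ne hn fun i hi => hk ⟨i, hi.symm⟩]
    simp

theorem F_le_integral_abs {n : ℕ} (hn : 1 ≤ n) (j : ℕ) {τ : C(T, ℝ)} (hτ : τ ∈ trigPoly n) :
    F (j + 1) ≤ ∫ x, |chiPow (1 / (2 * n)) (j + 1) x - τ x| := by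
  have hn0 : (0 : ℝ) < n := by exact_mod_cast hn
  have hpos : (0 : ℝ) < 1 / (2 * n) := by positivity
  have hs := (memLp_top_sqWave n).integrable le_top
  have i1 : Integrable fun x => sqWave n x * chiPow (1 / (2 * n)) (j + 1) x :=
    hs.mul_of_top_left (memLp_top_chiPow hpos _)
  have i2 : Integrable fun x => sqWave n x * τ x :=
    hs.mul_of_top_left (memLp_top_continuousMap τ)
  have h1 : F (j + 1) = ∫ x, sqWave n x * (chiPow (1 / (2 * n)) (j + 1) x - τ x) := by
    simp only [mul_sub]
    rw [integral_sub i1 i2, integral_sqWave_mul_chiPow hn, integral_sqWave_mul_eq_zero hn hτ,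
      sub_zero]
  rw [h1]
  refine integral_mono ?_ ((integrable_chiPow hpos _).sub (integrable_continuousMap τ)).abs
    fun x => ?_
  · simp only [mul_sub]
    exact i1.sub i2
  · refine (le_abs_self _).trans ?_
    rw [abs_mul, abs_sqWave, one_mul]

theorem F_succ_le_chiErr {n : ℕ} (hn : 1 ≤ n) (j : ℕ) :
    F (j + 1) ≤ chiErr n (1 / (2 * n)) (j + 1) :=
  le_ciInf fun τ => F_le_integral_abs hn j τ.2

/-- The pairing formula with n = 1: the square wave equals 1 on (-1/4, 1/4), the support of χ_{1/2},
so the pairing is the total mass of the kernel. -/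
theorem F_one : F 1 = 1 := by
  have h1 := integral_sqWave_mul_chiPow le_rfl 0
  have hpos : (0 : ℝ) < 1 / (2 * (1 : ℕ)) := by norm_num
  have h2 := integral_mul_chi (𝕜 := ℝ) hpos (memLp_top_sqWave 1)
  simp only [RCLike.ofReal_real_eq_id, id] at h2
  refine h1.symm.trans (h2.symm.trans ?_)
  refine Eq.trans ?_ (integral_chi hpos)
  refine integral_congr_ae (.of_forall fun t => ?_)
  simp only [chi]
  by_cases ht : t ∈ Set.Ioo (-(1 / (2 * (1 : ℕ)) : ℝ) / 2) ((1 / (2 * (1 : ℕ)) : ℝ) / 2)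
  · rw [sqWave_coe_eq le_rfl (r := 0) (by simpa using ht), pow_zero, one_mul]
  · rw [Set.indicator_of_notMem ht, mul_zero]

/-! ### Second differences of negative powers -/

/-- The second difference, centred at `y`, of the function `x ↦ x ^ (-p)`. -/
def secondDiffPow (p : ℕ) (y : ℝ) : ℝ :=
  (y - 1) ^ (-(p : ℤ)) - 2 * y ^ (-(p : ℤ)) + (y + 1) ^ (-(p : ℤ))

theorem secondDiffPow_nonneg (p : ℕ) {y : ℝ} (hy : 1 < y) : 0 ≤ secondDiffPow p y := by
  have h1 : y - 1 ∈ Set.Ioi (0 : ℝ) := Set.mem_Ioi.2 (by linarith)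
  have h2 : y + 1 ∈ Set.Ioi (0 : ℝ) := Set.mem_Ioi.2 (by linarith)
  have h := (convexOn_zpow (𝕜 := ℝ) (-(p : ℤ))).2 h1 h2 (by norm_num : (0 : ℝ) ≤ 1 / 2)
    (by norm_num : (0 : ℝ) ≤ 1 / 2) (by norm_num)
  have e : (1 / 2 : ℝ) • (y - 1) + (1 / 2 : ℝ) • (y + 1) = y := by
    simp only [smul_eq_mul]
    ring
  rw [e] at h
  simp only [smul_eq_mul] at h
  rw [secondDiffPow]
  linarith

/-- The derivative is -p times the second difference for p + 1, which is nonnegative by convexity.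
-/
theorem antitoneOn_secondDiffPow (p : ℕ) : AntitoneOn (secondDiffPow p) (Set.Ioi 1) := by
  have hd : ∀ y ∈ Set.Ioi (1 : ℝ),
      HasDerivAt (secondDiffPow p) (-(p : ℝ) * secondDiffPow (p + 1) y) y := by
    intro y hy
    rw [Set.mem_Ioi] at hy
    have h1 := (hasDerivAt_zpow (-(p : ℤ)) (y - 1) (Or.inl (by linarith))).comp_sub_const y 1
    have h2 := hasDerivAt_zpow (-(p : ℤ)) y (Or.inl (by linarith))
    have h3 := (hasDerivAt_zpow (-(p : ℤ)) (y + 1) (Or.inl (by linarith))).comp_add_const y 1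
    convert! (h1.sub (h2.const_mul 2)).add h3 using 1
    rw [secondDiffPow, show (-((p + 1 : ℕ) : ℤ)) = -(p : ℤ) - 1 by push_cast; ring]
    push_cast
    ring
  refine antitoneOn_of_deriv_nonpos (convex_Ioi 1)
    (fun y hy => (hd y hy).continuousAt.continuousWithinAt)
    (fun y hy => (hd y (interior_subset hy)).differentiableAt.differentiableWithinAt)
    fun y hy => ?_
  rw [(hd y (interior_subset hy)).deriv, neg_mul, neg_nonpos]
  exact mul_nonneg (Nat.cast_nonneg _) (secondDiffPow_nonneg _ (Set.mem_Ioi.1 (interior_subset hy)))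

theorem zpow_neg_le_zpow_neg (p : ℕ) {x y : ℝ} (hx : 0 < x) (hxy : x ≤ y) :
    y ^ (-(p : ℤ)) ≤ x ^ (-(p : ℤ)) := by
  rw [zpow_neg, zpow_neg, zpow_natCast, zpow_natCast]
  gcongr

theorem tsum_sign_mul_nonneg {s : ℝ} (hs : s = 1 ∨ s = -1) {f : ℕ → ℝ} (hf : Antitone f)
    (hf0 : ∀ i, 0 ≤ f i) (hsum : Summable f) : 0 ≤ ∑' i, s ^ i * f i := by
  rcases hs with rfl | rfl
  · exact tsum_nonneg fun i => by simpa using hf0 i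
  · simpa using hf.alternating_series_le_tendsto hsum.tendsto_alternating_series_tsum 0

/-! ### The coefficients of the multiplier -/

/-- The series `∑ᵢ sⁱ (y + (2i+1)n)⁻ᵖ`, where `s = (-1)ᵖ⁺¹`. -/
def oddSeries (n p : ℕ) (y : ℝ) : ℝ :=
  ∑' i : ℕ, ((-1 : ℝ) ^ (p + 1)) ^ i * (y + (2 * i + 1) * n) ^ (-(p : ℤ))

section OddSeries

variable {n p : ℕ}

theorem add_succ_le_add_mul (hn : 1 ≤ n) (y : ℝ) (i : ℕ) :
    y + (i + 1) ≤ y + (2 * i + 1) * n := by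
  have h1 : (1 : ℝ) ≤ n := by exact_mod_cast hn
  have h2 : (0 : ℝ) ≤ i := Nat.cast_nonneg i
  nlinarith

theorem summable_zpow_neg (hn : 1 ≤ n) (hp : 2 ≤ p) {y : ℝ} (hy : 0 ≤ y) :
    Summable fun i : ℕ => (y + (2 * i + 1) * n) ^ (-(p : ℤ)) := by
  have h0 : Summable fun i : ℕ => 1 / ((i : ℝ) + 1) ^ 2 := by
    have := (summable_nat_add_iff 1).2 (Real.summable_one_div_nat_pow.2 one_lt_two)
    simpa using this
  refine Summable.of_nonneg_of_le (fun i => by positivity) (fun i => ?_) h0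
  have h1 := add_succ_le_add_mul hn y i
  have h2 : (0 : ℝ) ≤ i := Nat.cast_nonneg i
  refine (zpow_neg_le_zpow_neg p (by linarith : (0 : ℝ) < i + 1) (by linarith)).trans ?_
  rw [zpow_neg, zpow_natCast, one_div]
  gcongr
  linarith

theorem sign_pow_eq_one_or (p : ℕ) : (-1 : ℝ) ^ (p + 1) = 1 ∨ (-1 : ℝ) ^ (p + 1) = -1 :=
  neg_one_pow_eq_or ℝ _

theorem summable_sign_mul (p : ℕ) {f : ℕ → ℝ} (hf : Summable f) :
    Summable fun i : ℕ => ((-1 : ℝ) ^ (p + 1)) ^ i * f i := by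
  refine Summable.of_norm_bounded hf.norm fun i => ?_
  rw [norm_mul, norm_pow, norm_pow, norm_neg, norm_one, one_pow, one_pow, one_mul]

theorem antitone_zpow_neg (hn : 1 ≤ n) (p : ℕ) {y : ℝ} (hy : 0 ≤ y) :
    Antitone fun i : ℕ => (y + (2 * i + 1) * n) ^ (-(p : ℤ)) := by
  intro i j hij
  have h1 := add_succ_le_add_mul hn y i
  have h2 : (0 : ℝ) ≤ i := Nat.cast_nonneg i
  have h3 : (i : ℝ) ≤ j := by exact_mod_cast hij
  refine zpow_neg_le_zpow_neg p (by linarith) ?_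
  gcongr

theorem oddSeries_nonneg (hn : 1 ≤ n) (hp : 2 ≤ p) {y : ℝ} (hy : 0 ≤ y) : 0 ≤ oddSeries n p y :=
  tsum_sign_mul_nonneg (sign_pow_eq_one_or p) (antitone_zpow_neg hn p hy)
    (fun i => by positivity) (summable_zpow_neg hn hp hy)

/-- Splitting off i = 0. This recursion is the reason for the definition: it makes `multCoeff` solve
the coefficient equation of the multiplier. -/
theorem oddSeries_eq (hn : 1 ≤ n) (hp : 2 ≤ p) {y : ℝ} (hy : 0 ≤ y) :
    oddSeries n p y = (y + n) ^ (-(p : ℤ)) + (-1) ^ (p + 1) * oddSeries n p (y + 2 * n) := by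
  rw [oddSeries, (summable_sign_mul p (summable_zpow_neg hn hp hy)).tsum_eq_zero_add, oddSeries,
    ← tsum_mul_left]
  congr 1
  · simp
  · refine tsum_congr fun i => ?_
    rw [pow_succ', mul_assoc]
    have e : y + (2 * ((i + 1 : ℕ) : ℝ) + 1) * n = y + 2 * n + (2 * i + 1) * n := by
      push_cast
      ring
    rw [e]

/-- The terms have nonnegative second differences that decrease in i, so their signed sum is
nonnegative whether or not the signs alternate. -/
theorem two_mul_oddSeries_le (hn : 1 ≤ n) (hp : 2 ≤ p) {y : ℝ} (hy : 1 ≤ y) :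
    2 * oddSeries n p y ≤ oddSeries n p (y - 1) + oddSeries n p (y + 1) := by
  have s1 := summable_zpow_neg hn hp (by linarith : 0 ≤ y - 1)
  have s2 := summable_zpow_neg hn hp (by linarith : 0 ≤ y)
  have s3 := summable_zpow_neg hn hp (by linarith : 0 ≤ y + 1)
  have hD : ∀ i : ℕ, secondDiffPow p (y + (2 * i + 1) * n) =
      (y - 1 + (2 * i + 1) * n) ^ (-(p : ℤ)) - 2 * (y + (2 * i + 1) * n) ^ (-(p : ℤ)) +
        (y + 1 + (2 * i + 1) * n) ^ (-(p : ℤ)) := by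
    intro i
    rw [secondDiffPow]
    rw [add_sub_right_comm, add_right_comm y]
  have hgt : ∀ i : ℕ, 1 < y + (2 * i + 1) * n := fun i => by
    have h1 := add_succ_le_add_mul hn y i
    have h2 : (0 : ℝ) ≤ i := Nat.cast_nonneg i
    linarith
  have hs : Summable fun i : ℕ => secondDiffPow p (y + (2 * i + 1) * n) := by
    simp_rw [hD]
    exact (s1.sub (s2.mul_left 2)).add s3
  have h0 := tsum_sign_mul_nonneg (sign_pow_eq_one_or p)
    (f := fun i : ℕ => secondDiffPow p (y + (2 * i + 1) * n)) (fun i j hij => by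
      refine antitoneOn_secondDiffPow p (hgt i) (hgt j) ?_
      have h3 : (i : ℝ) ≤ j := by exact_mod_cast hij
      gcongr) (fun i => secondDiffPow_nonneg p (hgt i)) hs
  have h1 : ∑' i : ℕ, ((-1 : ℝ) ^ (p + 1)) ^ i * secondDiffPow p (y + (2 * i + 1) * n) =
      oddSeries n p (y - 1) - 2 * oddSeries n p y + oddSeries n p (y + 1) := by
    have t1 := (summable_sign_mul p s1).hasSum
    have t2 := (summable_sign_mul p s2).hasSum
    have t3 := (summable_sign_mul p s3).hasSum
    refine HasSum.tsum_eq (((t1.sub (t2.mul_left 2)).add t3).congr_fun fun i => ?_)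
    rw [hD]
    ring
  linarith

/-- For even p the series alternates and is at most its first term (m + n)^(-p). For odd p all signs
are positive, but then p ≥ 3, and splitting the exponent as 3/2 + 3/2 between m and i gives a
product of convergent series. -/
theorem summable_oddSeries_nat (hn : 1 ≤ n) (hp : 2 ≤ p) :
    Summable fun m : ℕ => oddSeries n p m := by
  have hn1 : (1 : ℝ) ≤ n := by exact_mod_cast hn
  rcases Nat.even_or_odd p with hev | hodd
  · have h0 : Summable fun m : ℕ => 1 / ((m : ℝ) + 1) ^ 2 := by
      have := (summable_nat_add_iff 1).2 (Real.summable_one_div_nat_pow.2 one_lt_two)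
      simpa using this
    refine Summable.of_nonneg_of_le (fun m => oddSeries_nonneg hn hp (Nat.cast_nonneg m))
      (fun m => ?_) h0
    have hm : (0 : ℝ) ≤ m := Nat.cast_nonneg m
    rw [oddSeries_eq hn hp hm, (hev.add_one).neg_one_pow]
    have h1 := oddSeries_nonneg hn hp (by positivity : (0 : ℝ) ≤ m + 2 * n)
    have h2 := zpow_neg_le_zpow_neg p (by linarith : (0 : ℝ) < m + 1)
      (by linarith : (m : ℝ) + 1 ≤ m + n)
    have h3 : ((m : ℝ) + 1) ^ (-(p : ℤ)) ≤ 1 / ((m : ℝ) + 1) ^ 2 := by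
      rw [zpow_neg, zpow_natCast, one_div]
      gcongr
      linarith
    linarith
  · have hp3 : 3 ≤ p := by
      rcases hodd with ⟨r, rfl⟩
      lia
    have h0 : Summable fun m : ℕ => 1 / ((m : ℝ) + 1) ^ (3 / 2 : ℝ) := by
      refine ((Real.summable_one_div_nat_add_rpow 1 (3 / 2)).2 (by norm_num)).congr fun m => ?_
      rw [abs_of_nonneg (by positivity)]
    refine Summable.of_nonneg_of_le (fun m => oddSeries_nonneg hn hp (Nat.cast_nonneg m))
      (fun m => ?_) (h0.mul_right (∑' i : ℕ, 1 / ((i : ℝ) + 1) ^ (3 / 2 : ℝ)))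
    have hm : (0 : ℝ) ≤ m := Nat.cast_nonneg m
    rw [oddSeries, (hodd.add_one).neg_one_pow, ← tsum_mul_left]
    simp only [one_pow, one_mul]
    refine (summable_zpow_neg hn hp hm).tsum_le_tsum (fun i => ?_) (h0.mul_left _)
    have h1 := add_succ_le_add_mul hn m i
    have h2 : (0 : ℝ) ≤ i := Nat.cast_nonneg i
    set y : ℝ := m + (2 * i + 1) * n with hy
    have hn2 : (i : ℝ) + 1 ≤ (2 * i + 1) * n := by nlinarith
    have hm1 : (m : ℝ) + 1 ≤ y := by linarith
    have hi1 : (i : ℝ) + 1 ≤ y := by linarith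
    have hy0 : 0 < y := by linarith
    rw [zpow_neg, zpow_natCast, one_div, one_div, ← mul_inv]
    gcongr
    calc ((m : ℝ) + 1) ^ (3 / 2 : ℝ) * ((i : ℝ) + 1) ^ (3 / 2 : ℝ)
        ≤ y ^ (3 / 2 : ℝ) * y ^ (3 / 2 : ℝ) := by gcongr
      _ = y ^ 3 := by
        rw [← Real.rpow_add hy0, ← Real.rpow_natCast]
        norm_num
      _ ≤ y ^ p := pow_le_pow_right₀ (by linarith) hp3

theorem summable_oddSeries_int (hn : 1 ≤ n) (hp : 2 ≤ p) :
    Summable fun m : ℤ => oddSeries n p |(m : ℝ)| := by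
  refine Summable.of_nat_of_neg ?_ ?_
  · simpa using summable_oddSeries_nat hn hp
  · simpa using summable_oddSeries_nat hn hp

theorem two_mul_oddSeries_abs_le (hn : 1 ≤ n) (hp : 2 ≤ p) {m : ℤ} (hm : m ≠ 0) :
    2 * oddSeries n p |(m : ℝ)| ≤
      oddSeries n p |((m - 1 : ℤ) : ℝ)| + oddSeries n p |((m + 1 : ℤ) : ℝ)| := by
  rcases lt_or_gt_of_ne hm with h | h
  · have h1 : (m : ℝ) ≤ -1 := by exact_mod_cast (by lia : m ≤ -1)
    have := two_mul_oddSeries_le hn hp (by linarith : (1 : ℝ) ≤ -m)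
    push_cast
    rw [abs_of_nonpos (by linarith), abs_of_nonpos (by linarith : (m : ℝ) - 1 ≤ 0),
      abs_of_nonpos (by linarith : (m : ℝ) + 1 ≤ 0)]
    rw [show -((m : ℝ) - 1) = -m + 1 by ring, show -((m : ℝ) + 1) = -m - 1 by ring]
    linarith
  · have h1 : (1 : ℝ) ≤ m := by exact_mod_cast h
    have := two_mul_oddSeries_le hn hp h1
    push_cast
    rwa [abs_of_nonneg (by linarith), abs_of_nonneg (by linarith : 0 ≤ (m : ℝ) - 1),
      abs_of_nonneg (by linarith : 0 ≤ (m : ℝ) + 1)]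

end OddSeries

/-! ### Nonnegative cosine series -/

theorem abs_cosT_le_one (k : ℤ) (x : T) : |cosT k x| ≤ 1 := by
  induction x using QuotientAddGroup.induction_on with
  | H x =>
    rw [cosT_coe]
    exact Real.abs_cos_le_one _

theorem cosT_neg (k : ℤ) (x : T) : cosT (-k) x = cosT k x := by
  induction x using QuotientAddGroup.induction_on with
  | H x =>
    rw [cosT_coe, cosT_coe, ← Real.cos_neg]
    congr 1
    push_cast
    ring

theorem cosT_add_add_cosT_sub (k : ℤ) (x y : T) :
    cosT k (x + y) + cosT k (x - y) = 2 * cosT k x * cosT k y := by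
  have h1 := cosT_sub k x y
  have h2 := cosT_sub k x (-y)
  have h3 := cosT_sub k 0 y
  have h4 := sinT_sub k 0 y
  simp only [zero_sub] at h3 h4
  have h5 : cosT k 0 = 1 := by
    change (fourier k (0 : T) : ℂ).re = 1
    simp
  have h6 : sinT k 0 = 0 := by
    change (fourier k (0 : T) : ℂ).im = 0
    simp
  rw [sub_neg_eq_add, h3, h4, h5, h6] at h2
  rw [h1, h2]
  ring

theorem two_mul_cosT_mul_cosT (k l : ℤ) (x : T) :
    2 * cosT k x * cosT l x = cosT (l + k) x + cosT (l - k) x := by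
  induction x using QuotientAddGroup.induction_on with
  | H x =>
    simp only [cosT_coe]
    rw [show 2 * Real.pi * ((l + k : ℤ) : ℝ) * x =
      2 * Real.pi * l * x + 2 * Real.pi * k * x by push_cast; ring,
      show 2 * Real.pi * ((l - k : ℤ) : ℝ) * x =
      2 * Real.pi * l * x - 2 * Real.pi * k * x by push_cast; ring, Real.cos_add, Real.cos_sub]
    ring

theorem summable_mul_cosT {β : ℤ → ℝ} (hβ : Summable β) (x : T) :
    Summable fun m => β m * cosT m x := by
  refine Summable.of_norm_bounded hβ.norm fun m => ?_
  rw [norm_mul]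
  exact mul_le_of_le_one_right (norm_nonneg _) (abs_cosT_le_one m x)

theorem hasSum_cosT_mul {β : ℤ → ℝ} (hβ : Summable β) (n : ℤ) (x : T) :
    HasSum (fun k => (β (k - n) + β (k + n)) / 2 * cosT k x)
      (cosT n x * ∑' m, β m * cosT m x) := by
  have h1 := (summable_mul_cosT hβ x).hasSum.mul_left (cosT n x)
  have s1 : Summable fun m => β m * cosT (m + n) x := by
    refine Summable.of_norm_bounded hβ.norm fun m => ?_
    rw [norm_mul]
    exact mul_le_of_le_one_right (norm_nonneg _) (abs_cosT_le_one _ x)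
  have s2 : Summable fun m => β m * cosT (m - n) x := by
    refine Summable.of_norm_bounded hβ.norm fun m => ?_
    rw [norm_mul]
    exact mul_le_of_le_one_right (norm_nonneg _) (abs_cosT_le_one _ x)
  have h2 : cosT n x * ∑' m, β m * cosT m x =
      ((∑' m, β m * cosT (m + n) x) + ∑' m, β m * cosT (m - n) x) * (1 / 2) := by
    refine h1.unique (((s1.hasSum.add s2.hasSum).mul_right (1 / 2)).congr_fun fun m => ?_)
    have := two_mul_cosT_mul_cosT n m x
    linear_combination β m / 2 * this
  rw [h2]
  have t1 := (Equiv.subRight n).hasSum_iff.2 s1.hasSum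
  have t2 := (Equiv.addRight n).hasSum_iff.2 s2.hasSum
  refine ((t1.add t2).mul_right (1 / 2)).congr_fun fun k => ?_
  simp only [Function.comp_apply, Equiv.subRight_apply, Equiv.coe_addRight, sub_add_cancel,
    add_sub_cancel_right]
  ring

theorem cosT_eq_one_of_cosT_one_eq_one {x : T} (hx : cosT 1 x = 1) (m : ℤ) : cosT m x = 1 := by
  induction x using QuotientAddGroup.induction_on with
  | H x =>
    change cosT 1 (x : T) = 1 at hx
    rw [cosT_coe, Real.cos_eq_one_iff] at hx
    obtain ⟨k, hk⟩ := hx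
    rw [cosT_coe, Real.cos_eq_one_iff]
    refine ⟨m * k, ?_⟩
    push_cast at hk ⊢
    linear_combination m * hk

/-- Multiply by 2(1 - cos 2πx). The new coefficients 2β(m) - β(m-1) - β(m+1) are nonpositive for m ≠
0 and have sum 0, so replacing cos 2πmx by 1 can only lower the sum, down to 0. Where cos 2πx = 1
the claim is just ∑ β ≥ 0. -/
theorem tsum_mul_cosT_nonneg_of_convex {β : ℤ → ℝ} (hβ : Summable β) (h0 : ∀ m, 0 ≤ β m)
    (hc : ∀ m, m ≠ 0 → 2 * β m ≤ β (m - 1) + β (m + 1)) (x : T) :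
    0 ≤ ∑' m, β m * cosT m x := by
  rcases (abs_le.1 (abs_cosT_le_one 1 x)).2.eq_or_lt with h1 | h1
  · refine tsum_nonneg fun m => ?_
    rw [cosT_eq_one_of_cosT_one_eq_one h1, mul_one]
    exact h0 m
  · have a1 := (summable_mul_cosT hβ x).hasSum.mul_left 2
    have a2 := (hasSum_cosT_mul hβ 1 x).mul_left 2
    have b1 := hβ.hasSum.mul_left 2
    have b2 : HasSum (fun m => β (m - 1)) (∑' m, β m) :=
      (Equiv.subRight (1 : ℤ)).hasSum_iff.2 hβ.hasSum
    have b3 : HasSum (fun m => β (m + 1)) (∑' m, β m) :=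
      (Equiv.addRight (1 : ℤ)).hasSum_iff.2 hβ.hasSum
    have hle := hasSum_le (fun m => ?_) ((b1.sub b2).sub b3) (a1.sub a2)
    · nlinarith
    · rcases eq_or_ne m 0 with rfl | hm
      · rw [cosT_zero]
        linarith
      · have h2 := hc m hm
        have h3 := (abs_le.1 (abs_cosT_le_one m x)).2
        nlinarith

/-- Multiplying the m-th coefficient by cos(2πma) replaces the function by the mean of its
translates by a and -a. -/
theorem tsum_mul_cosT_pow_mul_cosT_nonneg {β : ℤ → ℝ} (hβ : Summable β) {a : T}
    (h : ∀ x, 0 ≤ ∑' m, β m * cosT m x) (s : ℕ) :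
    (Summable fun m => β m * cosT m a ^ s) ∧
      ∀ x, 0 ≤ ∑' m, β m * cosT m a ^ s * cosT m x := by
  induction s with
  | zero => simpa using ⟨hβ, h⟩
  | succ s ih =>
    obtain ⟨hs, hp⟩ := ih
    have hs' : Summable fun m => β m * cosT m a ^ (s + 1) := by
      simpa only [pow_succ, mul_assoc] using summable_mul_cosT hs a
    refine ⟨hs', fun x => ?_⟩
    have h1 := ((summable_mul_cosT hs (x + a)).hasSum.add
      (summable_mul_cosT hs (x - a)).hasSum).mul_right (1 / 2)
    have h2 : HasSum (fun m => β m * cosT m a ^ (s + 1) * cosT m x) _ :=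
      h1.congr_fun fun m => by
        have := cosT_add_add_cosT_sub m x a
        rw [pow_succ]
        linear_combination -(β m * cosT m a ^ s / 2) * this
    rw [h2.tsum_eq]
    have := hp (x + a)
    have := hp (x - a)
    positivity

/-! ### The best approximation of the convolution powers -/

theorem cosT_mem_trigPoly {n : ℕ} {k : ℤ} (hk : k ∈ Finset.Ioo (-(n : ℤ)) n) :
    cosT k ∈ trigPoly n := by
  rw [Finset.mem_Ioo] at hk
  refine mem_trigPoly_iff.2 ⟨fun j => if j = k.natAbs then 1 else 0, 0, fun x => ?_⟩
  rw [Finset.sum_eq_single k.natAbs]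
  · rcases Int.natAbs_eq k with h | h
    · simp [← h]
    · have h1 : cosT k x = cosT (-(k.natAbs : ℤ)) x := by rw [← h]
      rw [h1, cosT_neg]
      simp
  · intro j _ hj
    simp [hj]
  · intro h
    exact absurd (Finset.mem_range.2 (by lia)) h

/-- Summable coefficients define a continuous function Z with the same Fourier coefficients as u;
uniqueness in L² identifies the two, and the cosine series is the real part of Z. -/
theorem ae_eq_tsum_mul_cosT {u : T → ℝ} (hu : MemLp u 2 volume) {c : ℤ → ℝ} (hc : Summable c)
    (h : ∀ k, fourierCoeff (fun x => (u x : ℂ)) k = c k) :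
    ∀ᵐ x, u x = ∑' k, c k * cosT k x := by
  have hs : Summable fun k => (c k : ℂ) • (fourier k : C(T, ℂ)) := by
    refine Summable.of_norm ?_
    refine hc.norm.congr fun k => ?_
    have h1 : ‖(fourier k : C(T, ℂ))‖ = 1 := fourier_norm (T := 1) k
    rw [norm_smul, h1, mul_one, Complex.norm_real]
  obtain ⟨Z, hZ⟩ := hs
  have hcoeff : ∀ k, fourierCoeff Z k = c k := by
    intro k
    have hL : HasSum (fun l => fourierCoeff (fun x : T => (c l : ℂ) * (fourier l x : ℂ)) k)
        (fourierCoeff Z k) := by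
      have h1 := (ContinuousMap.toLp (E := ℂ) 2 AddCircle.haarAddCircle ℂ).hasSum hZ
      have h2 := (innerSL ℂ (fourierBasis (T := 1) k)).hasSum h1
      have h3 : ∀ g : C(T, ℂ), innerSL ℂ (fourierBasis (T := 1) k)
          (ContinuousMap.toLp (E := ℂ) 2 AddCircle.haarAddCircle ℂ g) = fourierCoeff g k := by
        intro g
        rw [innerSL_apply_apply, ← HilbertBasis.repr_apply_apply, fourierBasis_repr,
          fourierCoeff_toLp]
      simp only [h3] at h2
      exact h2
    have h4 : ∀ l, fourierCoeff (fun x : T => (c l : ℂ) * (fourier l x : ℂ)) k =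
        if k = l then (c l : ℂ) else 0 := by
      intro l
      rw [fourierCoeff.const_mul, fourierCoeff_fourier_self]
      simp
    simp only [h4] at hL
    have h5 := hasSum_single (f := fun l => if k = l then (c l : ℂ) else 0) k fun l hl => by
      simp [Ne.symm hl]
    simpa using hL.unique h5
  have hae := ae_eq_of_fourierCoeff_eq (MemLp.ofReal (K := ℂ) hu)
    ((memLp_top_of_bound Z.continuous.aestronglyMeasurable ‖Z‖
      (.of_forall Z.norm_coe_le_norm)).mono_exponent le_top) fun k => (h k).trans (hcoeff k).symm
  filter_upwards [hae] with x hx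
  have h1 := (ContinuousMap.evalCLM ℂ x).hasSum hZ
  have h2 := Complex.hasSum_re h1
  have h3 : (Z x).re = u x := by
    rw [← hx]
    simp
  have h4 : HasSum (fun k => c k * cosT k x) (Z x).re := by
    refine h2.congr_fun fun k => ?_
    change _ = ((c k : ℂ) * (fourier k x : ℂ)).re
    rw [Complex.re_ofReal_mul]
    rfl
  rw [← h3, h4.tsum_eq]

section Upper

variable {n p : ℕ}

/-- The coefficients of a nonnegative function whose product with `cos (2πnx)` agrees with the
`p`-th convolution power of the periodized `χ_h`, `h = 1 / (2n)`, up to a trigonometric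
polynomial of degree less than `n`. -/
def multCoeff (n p : ℕ) (m : ℤ) : ℝ :=
  2 * (2 * n / Real.pi) ^ p * (oddSeries n p |(m : ℝ)| * cosT m ((1 / (4 * n) : ℝ) : T) ^ p)

theorem multCoeff_neg (m : ℤ) : multCoeff n p (-m) = multCoeff n p m := by
  rw [multCoeff, multCoeff, cosT_neg, Int.cast_neg, abs_neg]

theorem summable_multCoeff_and_nonneg (hn : 1 ≤ n) (hp : 2 ≤ p) :
    Summable (multCoeff n p) ∧ ∀ x, 0 ≤ ∑' m, multCoeff n p m * cosT m x := by
  have h := tsum_mul_cosT_pow_mul_cosT_nonneg (summable_oddSeries_int hn hp)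
    (a := ((1 / (4 * n) : ℝ) : T))
    (tsum_mul_cosT_nonneg_of_convex (summable_oddSeries_int hn hp)
      (fun m => oddSeries_nonneg hn hp (abs_nonneg _))
      fun m hm => two_mul_oddSeries_abs_le hn hp hm) p
  refine ⟨h.1.mul_left _, fun x => ?_⟩
  simp only [multCoeff, mul_assoc]
  rw [tsum_mul_left, tsum_mul_left]
  have h2 := h.2 x
  simp only [mul_assoc] at h2
  positivity

/-- With k = m + n, the shift by 2n turns cos(πm/2n) into its negative, so the right side becomes a
p-th power of cosine times S(m) + (-1)^p S(m + 2n), and `oddSeries_eq` collapses the last factor to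
(m + n)^(-p). -/
theorem sinc_pow_eq_multCoeff_of_le (hn : 1 ≤ n) (hp : 2 ≤ p) {k : ℤ} (hk : (n : ℤ) ≤ k) :
    sinc (Real.pi * k * (1 / (2 * n))) ^ p =
      (multCoeff n p (k - n) + multCoeff n p (k + n)) / 2 := by
  have hn0 : (0 : ℝ) < n := by exact_mod_cast hn
  have hpi := Real.pi_pos
  obtain ⟨m, rfl⟩ : ∃ m : ℕ, k = m + n := ⟨(k - n).toNat, by lia⟩
  have hm : (0 : ℝ) ≤ m := Nat.cast_nonneg m
  have h1 : cosT ((m : ℤ) + n - n) ((1 / (4 * n) : ℝ) : T) = Real.cos (Real.pi * m / (2 * n)) := by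
    rw [cosT_coe]
    congr 1
    push_cast
    field_simp
    ring
  have h2 : cosT ((m : ℤ) + n + n) ((1 / (4 * n) : ℝ) : T) =
      -Real.cos (Real.pi * m / (2 * n)) := by
    rw [cosT_coe, ← Real.cos_add_pi]
    congr 1
    push_cast
    field_simp
    ring
  have h3 : sinc (Real.pi * ((m + n : ℤ) : ℝ) * (1 / (2 * n))) =
      Real.cos (Real.pi * m / (2 * n)) * (2 * n / Real.pi) * ((m : ℝ) + n)⁻¹ := by
    have e : Real.pi * ((m + n : ℤ) : ℝ) * (1 / (2 * n)) =
        Real.pi * m / (2 * n) + Real.pi / 2 := by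
      push_cast
      field_simp
    have e' : Real.pi * m / (2 * n) + Real.pi / 2 = Real.pi * (m + n) / (2 * n) := by
      field_simp
    rw [e, Real.sinc_of_ne_zero (by positivity), Real.sin_add_pi_div_two, e']
    field_simp
  have h4 := oddSeries_eq hn hp hm
  rw [multCoeff, multCoeff, h1, h2, h3, neg_pow (Real.cos _)]
  push_cast
  rw [add_sub_cancel_right, abs_of_nonneg hm, abs_of_nonneg (by positivity : (0 : ℝ) ≤ m + n + n),
    show (m : ℝ) + n + n = m + 2 * n by ring, h4, mul_pow, mul_pow, zpow_neg, zpow_natCast, inv_pow,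
    pow_succ]
  ring

theorem sinc_pow_eq_multCoeff (hn : 1 ≤ n) (hp : 2 ≤ p) {k : ℤ}
    (hk : k ∉ Finset.Ioo (-(n : ℤ)) n) :
    sinc (Real.pi * k * (1 / (2 * n))) ^ p =
      (multCoeff n p (k - n) + multCoeff n p (k + n)) / 2 := by
  rw [Finset.mem_Ioo, not_and_or, not_lt, not_lt] at hk
  rcases hk with hk | hk
  · have h := sinc_pow_eq_multCoeff_of_le hn hp (k := -k) (by lia)
    rw [← Real.sinc_neg, ← multCoeff_neg (k - n), ← multCoeff_neg (k + n)]
    push_cast at h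
    rw [show -(Real.pi * k * (1 / (2 * n))) = Real.pi * -k * (1 / (2 * n)) by ring, h,
      show -(k - n : ℤ) = -k + n by ring, show -(k + n : ℤ) = -k - n by ring, add_comm]
  · exact sinc_pow_eq_multCoeff_of_le hn hp hk

theorem summable_sinc_pow {h : ℝ} (hh : 0 < h) (hp : 2 ≤ p) :
    Summable fun k : ℤ => sinc (Real.pi * k * h) ^ p := by
  have hsum := hasSum_conj_fourierCoeff_mul
    ((MemLp.ofReal (K := ℂ) (memLp_top_chiPer hh)).mono_exponent (p := 2) le_top)
    ((MemLp.ofReal (K := ℂ) (memLp_top_chiPer hh)).mono_exponent (p := 2) le_top)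
  simp only [RCLike.ofReal_eq_complex_ofReal, fourierCoeff_chiPer hh, Complex.conj_ofReal,
    ← Complex.ofReal_mul] at hsum
  refine Summable.of_norm_bounded (Complex.summable_ofReal.1 hsum.summable) fun k => ?_
  obtain ⟨r, rfl⟩ := Nat.exists_eq_add_of_le hp
  rw [Real.norm_eq_abs, pow_add, abs_mul, abs_pow, abs_pow, sq_abs, pow_two]
  exact mul_le_of_le_one_right (mul_self_nonneg _)
    (pow_le_one₀ (abs_nonneg _) (Real.abs_sinc_le_one _))

theorem exists_trigPoly_ae_eq (hn : 1 ≤ n) (j : ℕ) :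
    ∃ τ ∈ trigPoly n, ∃ Q : T → ℝ, (∀ x, 0 ≤ Q x) ∧
      ∀ᵐ x, chiPow (1 / (2 * n)) (j + 2) x - τ x = cosT n x * Q x := by
  have hn0 : (0 : ℝ) < n := by exact_mod_cast hn
  have hpos : (0 : ℝ) < 1 / (2 * n) := by positivity
  have hp : 2 ≤ j + 2 := by lia
  obtain ⟨hq, hQ⟩ := summable_multCoeff_and_nonneg hn hp
  set c : ℤ → ℝ := fun k => sinc (Real.pi * k * (1 / (2 * n))) ^ (j + 2) with hc
  have hcs : Summable c := summable_sinc_pow hpos hp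
  -- The cosine coefficients of χ^p - cos(2πnx)·Q. They vanish for |k| ≥ n, so the difference is a
  -- trigonometric polynomial τ.
  set d : ℤ → ℝ := fun k =>
    c k - (multCoeff n (j + 2) (k - n) + multCoeff n (j + 2) (k + n)) / 2 with hd
  refine ⟨∑ k ∈ Finset.Ioo (-(n : ℤ)) n, d k • cosT k,
    Submodule.sum_mem _ fun k hk => Submodule.smul_mem _ _ (cosT_mem_trigPoly hk),
    fun x => ∑' m, multCoeff n (j + 2) m * cosT m x, hQ, ?_⟩
  filter_upwards [ae_eq_tsum_mul_cosT
    ((memLp_top_chiPow hpos (j + 2)).mono_exponent (p := 2) le_top) hcs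
    fun k => fourierCoeff_chiPow hpos k (j + 1)] with x hx
  have h1 := (summable_mul_cosT hcs x).hasSum.sub (hasSum_cosT_mul hq n x)
  have h2 : HasSum (fun k => d k * cosT k x) (∑ k ∈ Finset.Ioo (-(n : ℤ)) n, d k * cosT k x) := by
    refine hasSum_sum_of_ne_finset_zero fun k hk => ?_
    simp only [hd, hc]
    rw [sinc_pow_eq_multCoeff hn hp hk, sub_self, zero_mul]
  have h3 := h2.unique (h1.congr_fun fun k => sub_mul _ _ _)
  rw [hx]
  simp only [ContinuousMap.sum_apply, ContinuousMap.smul_apply, smul_eq_mul]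
  rw [h3]
  ring

/-- For exponents at least 2 the difference χ^p - τ = cos(2πnx)·Q has the sign of the square wave
wherever it is nonzero, so its L¹ norm equals the pairing. For exponent 1, outside the reach of the
multiplier, τ = 0 already attains F_1 = 1. -/
theorem chiErr_eq_F (hn : 1 ≤ n) : ∀ j, chiErr n (1 / (2 * n)) j = F j
  | 0 => by rw [chiErr, bestTV_dirac, F_zero]
  | 1 => by
    have hn0 : (0 : ℝ) < n := by exact_mod_cast hn
    have hpos : (0 : ℝ) < 1 / (2 * n) := by positivity
    refine le_antisymm ((bestL1_le _ (trigPoly n).zero_mem).trans (le_of_eq ?_))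
      (F_succ_le_chiErr hn 0)
    simp only [ContinuousMap.zero_apply, sub_zero, abs_of_nonneg (chiPow_nonneg hpos _ _)]
    rw [integral_chiPow hpos, F_one]
  | j + 2 => by
    have hn0 : (0 : ℝ) < n := by exact_mod_cast hn
    have hpos : (0 : ℝ) < 1 / (2 * n) := by positivity
    refine le_antisymm ?_ (F_succ_le_chiErr hn (j + 1))
    obtain ⟨τ, hτ, Q, hQ, hae⟩ := exists_trigPoly_ae_eq hn j
    refine (bestL1_le _ hτ).trans (le_of_eq ?_)
    have hs := (memLp_top_sqWave n).integrable le_top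
    have i1 : Integrable fun x => sqWave n x * chiPow (1 / (2 * n)) (j + 1 + 1) x :=
      hs.mul_of_top_left (memLp_top_chiPow hpos _)
    have i2 : Integrable fun x => sqWave n x * τ x :=
      hs.mul_of_top_left (memLp_top_continuousMap τ)
    have h1 := integral_sub i1 i2
    rw [integral_sqWave_mul_chiPow hn, integral_sqWave_mul_eq_zero hn hτ, sub_zero] at h1
    rw [← h1]
    refine integral_congr_ae ?_
    filter_upwards [hae] with x hx
    rw [← mul_sub]
    change |chiPow (1 / (2 * n)) (j + 2) x - τ x| =
      sqWave n x * (chiPow (1 / (2 * n)) (j + 2) x - τ x)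
    rw [hx, ← mul_assoc, sqWave_mul_cosT, abs_mul, abs_of_nonneg (hQ x)]

end Upper

end TPerp

end

/-! ### Assembly of both statements. -/

theorem mainTheorem3 (n : ℕ) (hn : 1 ≤ n) :
    -- arbitrary step
    (∀ h : ℝ, 0 < h →
      Summable (TPerp.chiErr n h) ∧
      (∀ g : TPerp.T → ℝ, TPerp.IsPerp n g →
        Tendsto (fun N : ℕ => eLpNorm (fun x => g x - ∑ j ∈ Finset.range N,
            TPerp.powConv h j (fun y => g y - TPerp.steklov h g y) x) ⊤ volume)
          atTop (𝓝 0) ∧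
        TPerp.essNorm g ≤
          2 * TPerp.W2ess g h + TPerp.chiErr n h 2 * TPerp.essNorm g ∧
        (TPerp.chiErr n h 2 < 1 →
          TPerp.essNorm g ≤ 2 * (1 - TPerp.chiErr n h 2)⁻¹ * TPerp.W2ess g h) ∧
        TPerp.essNorm g ≤ (1 + ∑' j : ℕ, TPerp.chiErr n h (j + 1)) * TPerp.W2ess g h) ∧
      (∀ f : C(TPerp.T, ℝ),
        TPerp.bestUnif n f ≤ (∑' j : ℕ, TPerp.chiErr n h j) * TPerp.W2 f h)) ∧
    -- the step `1 / (2n)`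
    (∀ j : ℕ, TPerp.chiErr n (1 / (2 * n)) j = TPerp.F j) ∧
    TPerp.chiErr n (1 / (2 * n)) 2 = 1 / 2 ∧
    HasSum TPerp.F (1 / Real.cos 1 + Real.tan 1) ∧
    (3.408 < 1 / Real.cos 1 + Real.tan 1 ∧ 1 / Real.cos 1 + Real.tan 1 < 3.409) ∧
    (∀ g : TPerp.T → ℝ, TPerp.IsPerp n g →
      TPerp.essNorm g ≤ (1 / Real.cos 1 + Real.tan 1) * TPerp.W2ess g (1 / (2 * n)) ∧
      TPerp.essNorm g ≤ 4 * TPerp.W2ess g (1 / (2 * n))) ∧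
    (∀ f : C(TPerp.T, ℝ),
      TPerp.bestUnif n f ≤ (1 / Real.cos 1 + Real.tan 1) * TPerp.W2 f (1 / (2 * n)) ∧
      TPerp.bestUnif n f ≤ 4 * TPerp.W2 f (1 / (2 * n))) := by
  have hn0 : (0 : ℝ) < n := by exact_mod_cast hn
  have hpos : (0 : ℝ) < 1 / (2 * n) := by positivity
  have hE : ∀ j, TPerp.chiErr n (1 / (2 * n)) j = TPerp.F j := TPerp.chiErr_eq_F hn
  have hE2 : TPerp.chiErr n (1 / (2 * n)) 2 = 1 / 2 := (hE 2).trans TPerp.F_two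
  have hgen : ∀ h : ℝ, ∀ g : TPerp.T → ℝ, 0 < h → TPerp.IsPerp n g → TPerp.chiErr n h 2 < 1 →
      TPerp.essNorm g ≤ 2 * (1 - TPerp.chiErr n h 2)⁻¹ * TPerp.W2ess g h := by
    intro h g hh hg hlt
    have := TPerp.essNorm_le_two_mul hh hg
    have hsub : 0 < 1 - TPerp.chiErr n h 2 := by linarith
    rw [mul_right_comm, ← div_eq_mul_inv, le_div_iff₀ hsub]
    linarith
  have hsum : ∑' j : ℕ, TPerp.chiErr n (1 / (2 * n)) j = 1 / Real.cos 1 + Real.tan 1 := by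
    simp_rw [hE]
    exact TPerp.hasSum_F.tsum_eq
  have hsum' : 1 + ∑' j : ℕ, TPerp.chiErr n (1 / (2 * n)) (j + 1) =
      1 / Real.cos 1 + Real.tan 1 := by
    rw [← hsum, (TPerp.summable_chiErr hn hpos).tsum_eq_zero_add, hE 0, TPerp.F_zero]
  refine ⟨fun h hh => ⟨TPerp.summable_chiErr hn hh, fun g hg =>
    ⟨TPerp.tendsto_eLpNorm_sub_sum_powConv hn hh hg, TPerp.essNorm_le_two_mul hh hg,
      hgen h g hh hg, TPerp.essNorm_le_tsum_mul hn hh hg⟩,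
    TPerp.bestUnif_le_tsum_mul hn hh⟩, hE, hE2, TPerp.hasSum_F, TPerp.sec_add_tan_one_bounds,
    fun g hg => ⟨?_, ?_⟩, fun f => ⟨?_, ?_⟩⟩
  · rw [← hsum']
    exact TPerp.essNorm_le_tsum_mul hn hpos hg
  -- With error 1/2 for the second power, 2(1 - 1/2)⁻¹ = 4.
  · have := hgen _ g hpos hg (by rw [hE2]; norm_num)
    rw [hE2] at this
    norm_num at this ⊢
    exact this
  · rw [← hsum]
    exact TPerp.bestUnif_le_tsum_mul hn hpos f
  -- For continuous f the constant 4 is only the numerical bound sec 1 + tan 1 < 3.409.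
  · refine (TPerp.bestUnif_le_tsum_mul hn hpos f).trans ?_
    rw [hsum]
    have hW : 0 ≤ TPerp.W2 f (1 / (2 * n)) := Real.iSup_nonneg fun _ => abs_nonneg _
    have := TPerp.sec_add_tan_one_bounds.2
    gcongr
    linarith
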